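/- Let $X$ be a Banach space over $\mathbb K\in\{\mathbb R,\mathbb C\}$. **Definitions.** Let $(\Omega,\mathcal F,\mathbb P)$ be a probability space with a filtration $(\mathcal F_n)_{n\ge 0}$. A sequence $(d_n)_{n\ge0}$ of integrable adapted $X$-valued functions is a *martingale difference sequence* if $\mathbb E[d_{n+1}\mid\mathcal F_n]=0$ for all $n\ge 0$. For $1<p<\infty$, a number $\beta\ge0$ is a *UMD$_p$-bound* for $X$ if $$\Bigl(\mathbb E\Bigl\|\sum_{j=1}^n\varepsilon_jd_j\Bigr\|^p\Bigr)^{1/p}\le\beta\Bigl(\mathbb E\Bigl\|\sum_{j=1}^nd_j\Bigr\|^p\Bigr)^{1/p}$$ for every probability space with a filtration, every martingale difference sequence $(d_n)$ with all $d_n\in L^p(\Omega;X)$, all $n\ge1$, and all $\varepsilon_j\in\mathbb K$ with $|\varepsilon_j|=1$. $X$ is a *UMD space* if it has a UMD$_p$-bound for some $p\in(1,\infty)$; $\beta_{p,X}$ denotes the infimum of the UMD$_p$-bounds of $X$. For adapted $X$-valued $(f_n)_{n\ge0},(g_n)_{n\ge0}$ put $df_n=f_n-f_{n-1}$ and $dg_n=g_n-g_{n-1}$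 for $n\ge1$, and $df_0=f_0$, $dg_0=g_0$; $g$ is *weakly differentially subordinated* to $f$ if for all $x^*\in X^*$ and all $n\ge0$, $|\langle dg_n,x^*\rangle|\le|\langle df_n,x^*\rangle|$ almost surely. For $p\in(1,\infty)$ and $\beta\ge0$ let $(\mathrm W_{p,\beta})$ be the following assertion: for every probability space with a filtration $(\mathcal F_n)_{n\ge0}$ such that $\mathcal F_0=\{\varnothing,\Omega\}$, and all $X$-valued local martingales $f,g$ such that $g$ is weakly differentially subordinated to $f$, $$\mathbb E\|g_n\|^p\le\beta^p\,\mathbb E\|f_n\|^p\quad\text{for all }n\ge1$$ (expectations take values in $[0,\infty]$). **Theorem.** 1. $X$ is a UMD space if and only if for some $p\in(1,\infty)$ there is $\beta>0$ with $(\mathrm W_{p,\beta})$, and if and only if for every $p\in(1,\infty)$ there is $\beta>0$ with $(\mathrm W_{p,\beta})$. 2. If $X$ is a UMD space and $p\in(1,\infty)$, then $\beta_{p,X}$ is the least UMD$_p$-bound of $X$, and it is also the least $\beta\ge0$ for which $(\mathrm W_{p,\beta})$ holds. 3. On any probability space with a filtration, for $X$-valued local martingales $f,g$: $g$ is weakly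 differentially subordinated to $f$ if and only if there is an adapted $\mathbb K$-valued sequence $(a_n)_{n\ge0}$ such that for all $n\ge0$, $|a_n|\le1$ and $dg_n=a_n\,df_n$ almost surely. 4. Let $X$ be a UMD space, let $(d_n)_{n\ge0}$, $(e_n)_{n\ge0}$ be $X$-valued martingale difference sequences with respect to a filtration on a probability space, and let $(a_n)_{n\ge0}$ be an adapted $\mathbb K$-valued sequence such that for all $n\ge0$, $|a_n|\le1$ and $e_n=a_nd_n$ almost surely. Then for all $p\in(1,\infty)$ and $n\ge0$, $$\mathbb E\Bigl\|\sum_{k<n}e_k\Bigr\|^p\le\beta_{p,X}^p\,\mathbb E\Bigl\|\sum_{k<n}d_k\Bigr\|^p .$$ If moreover $\sum_{k\ge0}d_k$ converges in $L^p(\Omega;X)$, then so does $\sum_{k\ge0}e_k$, and $\mathbb E\|\sum_{k\ge0}e_k\|^p\le\beta_{p,X}^p\,\mathbb E\|\sum_{k\ge0}d_k\|^p$. -/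

import Mathlib

open MeasureTheory ProbabilityTheory Filter Topology
open scoped ENNReal

universe u v w

/-- `d` is a martingale difference sequence for the filtration `ℱ`: adapted, integrable, and
`𝔼[d (n + 1) | ℱ n] = 0` a.s. for every `n`. The first term `d 0` is any integrable
`ℱ 0`-measurable function (it plays the role of the starting value of the martingale). -/
structure IsMartingaleDiff {Ω X : Type*} [NormedAddCommGroup X] [NormedSpace ℝ X]
    [CompleteSpace X] {m : MeasurableSpace Ω} (d : ℕ → Ω → X) (ℱ : Filtration ℕ m)
    (μ : Measure Ω) : Prop where
  adapted : StronglyAdapted ℱ d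
  integrable : ∀ n, Integrable (d n) μ
  condExp_succ : ∀ n, μ[d (n + 1) | ℱ n] =ᵐ[μ] 0

/-- Discrete-time local martingales: adapted processes for which there are stopping times
`τ k ↑ ∞` a.s. such that every stopped process `(1_{τ k > 0} f n)^{τ k}` is a martingale. -/
def IsLocalMartingale {Ω X : Type*} [NormedAddCommGroup X] [NormedSpace ℝ X]
    [CompleteSpace X] {m : MeasurableSpace Ω} (f : ℕ → Ω → X) (ℱ : Filtration ℕ m)
    (μ : Measure Ω) : Prop :=
  StronglyAdapted ℱ f ∧ Locally (fun h => Martingale h ℱ μ) ℱ f μ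

/-- `g` is weakly differentially subordinated to `f`. The exceptional null set may depend on the
functional. -/
structure WeaklyDiffSubordinate (𝕜 : Type*) [RCLike 𝕜] {Ω X : Type*} [NormedAddCommGroup X]
    [NormedSpace 𝕜 X] {m : MeasurableSpace Ω} (g f : ℕ → Ω → X) (μ : Measure Ω) : Prop where
  zero : ∀ φ : StrongDual 𝕜 X, ∀ᵐ ω ∂μ, ‖φ (g 0 ω)‖ ≤ ‖φ (f 0 ω)‖
  succ : ∀ n, ∀ φ : StrongDual 𝕜 X, ∀ᵐ ω ∂μ,
    ‖φ (g (n + 1) ω - g n ω)‖ ≤ ‖φ (f (n + 1) ω - f n ω)‖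

/-- `β` is admissible in the definition of the UMD property with exponent `p`: for every
martingale difference sequence `d 1, …, d n` in `L^p(Ω; X)` on any probability space (with
`𝔼[d j | ℱ (j - 1)] = 0` for `1 ≤ j ≤ n`) and all scalars with `|ε j| = 1`,
`‖∑ ε j • d j‖_{L^p} ≤ β ‖∑ d j‖_{L^p}`. -/
def UMDBound (𝕜 : Type u) [RCLike 𝕜] (X : Type v) [NormedAddCommGroup X]
    [NormedSpace 𝕜 X] [NormedSpace ℝ X] [CompleteSpace X] (p β : ℝ) : Prop :=
  ∀ (Ω : Type w) (m : MeasurableSpace Ω) (μ : Measure Ω) (_ : IsProbabilityMeasure μ)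
    (ℱ : Filtration ℕ m) (d : ℕ → Ω → X),
    IsMartingaleDiff d ℱ μ → (∀ j, MemLp (d j) (ENNReal.ofReal p) μ) →
    ∀ ε : ℕ → 𝕜, (∀ j, ‖ε j‖ = 1) → ∀ n : ℕ, 1 ≤ n →
      eLpNorm (fun ω => ∑ j ∈ Finset.Icc 1 n, ε j • d j ω) (ENNReal.ofReal p) μ ≤
        ENNReal.ofReal β * eLpNorm (fun ω => ∑ j ∈ Finset.Icc 1 n, d j ω) (ENNReal.ofReal p) μ

/-- `X` is a UMD space: for some `p ∈ (1, ∞)` there is an admissible constant. -/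
def IsUMD (𝕜 : Type u) [RCLike 𝕜] (X : Type v) [NormedAddCommGroup X]
    [NormedSpace 𝕜 X] [NormedSpace ℝ X] [CompleteSpace X] : Prop :=
  ∃ p : ℝ, 1 < p ∧ ∃ β : ℝ, 0 < β ∧ UMDBound.{u, v, w} 𝕜 X p β

/-- The UMD constant `β_{p,X}`. -/
noncomputable def umdConst (𝕜 : Type u) [RCLike 𝕜] (X : Type v)
    [NormedAddCommGroup X] [NormedSpace 𝕜 X] [NormedSpace ℝ X] [CompleteSpace X] (p : ℝ) : ℝ :=
  sInf {β : ℝ | 0 ≤ β ∧ UMDBound.{u, v, w} 𝕜 X p β}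

/-- `β` is admissible in the `L^p` estimate for weakly differentially subordinated local
martingales (on filtrations whose initial σ-algebra is trivial). Expectations are
`[0, ∞]`-valued. -/
def WeakSubBound (𝕜 : Type u) [RCLike 𝕜] (X : Type v) [NormedAddCommGroup X]
    [NormedSpace 𝕜 X] [NormedSpace ℝ X] [CompleteSpace X] (p β : ℝ) : Prop :=
  ∀ (Ω : Type w) (m : MeasurableSpace Ω) (μ : Measure Ω) (_ : IsProbabilityMeasure μ)
    (ℱ : Filtration ℕ m) (f g : ℕ → Ω → X), ℱ 0 = ⊥ →
    IsLocalMartingale f ℱ μ → IsLocalMartingale g ℱ μ → WeaklyDiffSubordinate 𝕜 g f μ →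
    ∀ n : ℕ, 1 ≤ n →
      ∫⁻ ω, ‖g n ω‖ₑ ^ p ∂μ ≤ ENNReal.ofReal β ^ p * ∫⁻ ω, ‖f n ω‖ₑ ^ p ∂μ

/-!
The proof replaces all the constants in the theorem by a single one, defined by finite games. A
`ZigzagTree` is a strategy for a pair of dyadic martingales `(x, y)` started at `(0, 0)`: at each
toss of a fair coin the increments are `± z` and `± e • z`, where `z` and the unimodular scalar `e`
depend on the past. `ZigzagBound 𝕜 X p β` says that the expectation of `‖y‖ ^ p - β ^ p ‖x‖ ^ p` at
the end is never positive.

*From `ZigzagBound` to all transforms, with the same constant.* Let `U (x, y)` be the supremum of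
the expected payoff over the strategies started at `(x, y)` (`zigzagEnvelope`, Burkholder's
function). It majorizes the payoff, is even, is convex in `y`, and is midpoint concave in all
directions `(z, e • z)` with `|e| = 1`; moreover it is finite and grows like a `p`-th power, since
from `(0, 0)` one gets to `(x, y)` in two steps (`ZigzagTree.val_le_neg_swap`). Hence `U` is locally
Lipschitz, and a linear functional below the Clarke derivative of `-U` gives a support of `U` from
above in all the directions `(z, a • z)` with `|a| ≤ 1` at once (`exists_support_envelope`). So if
`d` and `e` are martingale differences with `e k = a k • d k` and `|a k| ≤ 1`, where the `a k` need
not be predictable, the expectation of `U` along the pair of partial sums decreases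
(`integral_comp_add_le`), and the estimate follows (`IsTransformUpTo.lintegral_le`).

*From UMD bounds to `ZigzagBound`.* By carrying out the steps of different branches one after the
other, a strategy acquires multipliers that depend on the time only (`ZigzagTree.exists_isUniform`),
and the increments become martingale differences with predictable norms on a finite coin space
(`PredictableUMDBound.zigzagBound`). Thus the admissible constants for `UMDBound` are those for
`ZigzagBound`, and they form a closed set.

*Independence of the exponent.* For martingale differences with predictable norms a good-`λ`
inequality together with Doob's maximal inequality passes from one exponent to all others
(`PredictableUMDBound.exists_of_exponent`).

*Weak differential subordination.* A sequence of functionals separating the values of `df n` gives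
the multiplier as a quotient (`exists_multiplier`). A local martingale in discrete time that is
integrable at time `n` is a martingale up to time `n`, so the estimate for transforms applies to
`g` and `f` whenever the right-hand side is finite. Conversely the partial sums of martingale
differences from the first one on are a martingale that starts at `0`, so that nothing is lost by
making the initial σ-algebra trivial (`WeakSubBound.umdBound`).
-/

/-! ### Zigzag trees and the envelope of a payoff -/

section Tree

variable {𝕜 : Type u} [RCLike 𝕜] {X : Type v} [NormedAddCommGroup X] [NormedSpace 𝕜 X]

/-- Finite strategies for a pair of dyadic martingales. At `node z e l r` a fair coin is tossed and
the pair `(x, y)` moves to `(x + z, y + e • z)` (continuing with `l`) or to `(x - z, y - e • z)`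
(continuing with `r`); at a leaf the pair stops. The multipliers are unimodular. -/
inductive ZigzagTree (𝕜 : Type u) [RCLike 𝕜] (X : Type v) : Type (max u v)
  | leaf : ZigzagTree 𝕜 X
  | node (z : X) (e : Metric.sphere (0 : 𝕜) 1) (l r : ZigzagTree 𝕜 X) : ZigzagTree 𝕜 X

namespace ZigzagTree

/-- The expectation of `F` at the final position of the pair that starts at `(x, y)` and follows
the strategy. -/
noncomputable def val (F : X → X → ℝ) : ZigzagTree 𝕜 X → X → X → ℝ
  | leaf, x, y => F x y
  | node z e l r, x, y =>
    (val F l (x + z) (y + (e : 𝕜) • z) + val F r (x - z) (y - (e : 𝕜) • z)) / 2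

/-- The strategy with all increments reversed. -/
def neg : ZigzagTree 𝕜 X → ZigzagTree 𝕜 X
  | leaf => leaf
  | node z e l r => node (-z) e l.neg r.neg

variable {F : X → X → ℝ}

theorem val_neg (hF : ∀ x y, F (-x) (-y) = F x y) (t : ZigzagTree 𝕜 X) (x y : X) :
    t.neg.val F (-x) (-y) = t.val F x y := by
  induction t generalizing x y with
  | leaf => exact hF x y
  | node z e l r hl hr =>
    simp only [neg, val, ← hl, ← hr, smul_neg]
    congr 3 <;> abel

theorem convexOn_val [NormedSpace ℝ X] (hF : ∀ x, ConvexOn ℝ Set.univ (F x))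
    (t : ZigzagTree 𝕜 X) (x : X) : ConvexOn ℝ Set.univ (t.val F x) := by
  induction t generalizing x with
  | leaf => exact hF x
  | node z e l r hl hr =>
    refine ⟨convex_univ, fun y _ y' _ a b ha hb hab => ?_⟩
    have split : ∀ v : X, a • y + b • y' + v = a • (y + v) + b • (y' + v) := fun v => by
      rw [smul_add, smul_add, add_add_add_comm, ← add_smul, hab, one_smul]
    have h1 := (hl (x + z)).2 (Set.mem_univ (y + (e : 𝕜) • z)) (Set.mem_univ (y' + (e : 𝕜) • z))
      ha hb hab
    have h2 := (hr (x - z)).2 (Set.mem_univ (y + -((e : 𝕜) • z)))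
      (Set.mem_univ (y' + -((e : 𝕜) • z))) ha hb hab
    rw [← split] at h1 h2
    simp only [smul_eq_mul] at h1 h2
    simp only [val, smul_eq_mul, sub_eq_add_neg] at h1 h2 ⊢
    linarith

/-- The bound of any strategy by the value of the swapped payoff: the pair `(x, y)` can be reached
from `(0, 0)` in two steps, through `((x + y) / 2, (x + y) / 2)`, missing it at `(y, x)` only. -/
theorem val_le_neg_swap (hF : ∀ x y, F (-x) (-y) = F x y)
    (h0 : ∀ t : ZigzagTree 𝕜 X, t.val F 0 0 ≤ 0) (t : ZigzagTree 𝕜 X) (x y : X) :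
    t.val F x y ≤ -F y x := by
  have two : ∀ w : X, (2⁻¹ : 𝕜) • w + (2⁻¹ : 𝕜) • w = w := fun w => by
    rw [← two_smul 𝕜, smul_smul]; simp
  let e1 : Metric.sphere (0 : 𝕜) 1 := ⟨1, by simp⟩
  let e2 : Metric.sphere (0 : 𝕜) 1 := ⟨-1, by simp⟩
  set a : X := (2⁻¹ : 𝕜) • (x + y) with ha
  set b : X := (2⁻¹ : 𝕜) • (x - y) with hb
  have hab : a + b = x := by
    rw [ha, hb, ← smul_add, show x + y + (x - y) = x + x by abel, smul_add, two]
  have hab' : a - b = y := by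
    rw [ha, hb, ← smul_sub, show x + y - (x - y) = y + y by abel, smul_add, two]
  let A : ZigzagTree 𝕜 X := node b e2 t leaf
  have hA := h0 (node a e1 A A.neg)
  have h2 : A.neg.val F (-a) (-a) = A.val F a a := val_neg hF A a a
  have h3 : A.val F a a = (t.val F x y + F y x) / 2 := by
    simp only [A, val, e2, neg_smul, one_smul, ← sub_eq_add_neg, sub_neg_eq_add, hab, hab']
  simp only [val, e1, one_smul, zero_add, zero_sub] at hA
  rw [h2, h3] at hA
  linarith

end ZigzagTree

open ZigzagTree

/-- The largest expected payoff over all strategies started at `(x, y)`: the least majorant of `F`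
that is midpoint concave in every direction `(z, e • z)` with `|e| = 1`. -/
noncomputable def zigzagEnvelope (𝕜 : Type u) [RCLike 𝕜] {X : Type v} [NormedAddCommGroup X]
    [NormedSpace 𝕜 X] (F : X → X → ℝ) (w : X × X) : ℝ :=
  ⨆ t : ZigzagTree 𝕜 X, t.val F w.1 w.2

namespace zigzagEnvelope

instance : Nonempty (ZigzagTree 𝕜 X) := ⟨leaf⟩

variable {F : X → X → ℝ} (hF : ∀ x y, F (-x) (-y) = F x y)
  (h0 : ∀ t : ZigzagTree 𝕜 X, t.val F 0 0 ≤ 0)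
include hF h0

theorem bddAbove (x y : X) : BddAbove (Set.range fun t : ZigzagTree 𝕜 X => t.val F x y) :=
  ⟨-F y x, by rintro _ ⟨t, rfl⟩; exact val_le_neg_swap hF h0 t x y⟩

theorem le_self (x y : X) : F x y ≤ zigzagEnvelope 𝕜 F (x, y) :=
  le_ciSup (f := fun t : ZigzagTree 𝕜 X => t.val F x y) (bddAbove hF h0 x y) leaf

theorem le_neg_swap (x y : X) : zigzagEnvelope 𝕜 F (x, y) ≤ -F y x :=
  ciSup_le fun t => val_le_neg_swap hF h0 t x y

omit hF in
theorem zero_le : zigzagEnvelope 𝕜 F (0, 0) ≤ 0 := ciSup_le h0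

theorem neg_apply (w : X × X) : zigzagEnvelope 𝕜 F (-w) = zigzagEnvelope 𝕜 F w := by
  have key : ∀ w : X × X, zigzagEnvelope 𝕜 F w ≤ zigzagEnvelope 𝕜 F (-w) := fun w =>
    ciSup_le fun t => by
      rw [← val_neg hF]
      exact le_ciSup (f := fun t : ZigzagTree 𝕜 X => t.val F (-w).1 (-w).2)
        (bddAbove hF h0 _ _) t.neg
  refine le_antisymm ?_ (key w)
  simpa using key (-w)

theorem midpoint (w : X × X) (z : X) {e : 𝕜} (he : ‖e‖ = 1) :
    (zigzagEnvelope 𝕜 F (w + (z, e • z)) + zigzagEnvelope 𝕜 F (w - (z, e • z))) / 2 ≤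
      zigzagEnvelope 𝕜 F w := by
  rw [div_le_iff₀ two_pos, ← le_sub_iff_add_le]
  refine ciSup_le fun t => ?_
  rw [le_sub_comm]
  refine ciSup_le fun s => ?_
  have := le_ciSup (bddAbove hF h0 w.1 w.2) (node z ⟨e, by simpa using he⟩ t s)
  change _ ≤ zigzagEnvelope 𝕜 F w at this
  simp only [val] at this
  simp only [Prod.fst_add, Prod.snd_add, Prod.fst_sub, Prod.snd_sub]
  linarith

theorem convexOn_snd [NormedSpace ℝ X] (hconv : ∀ x, ConvexOn ℝ Set.univ (F x)) (x : X) :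
    ConvexOn ℝ Set.univ fun y => zigzagEnvelope 𝕜 F (x, y) := by
  refine ⟨convex_univ, fun y _ y' _ a b ha hb hab => ciSup_le fun t => ?_⟩
  refine ((convexOn_val hconv t x).2 (Set.mem_univ y) (Set.mem_univ y') ha hb hab).trans ?_
  simp only [smul_eq_mul]
  gcongr
  · exact le_ciSup (bddAbove hF h0 x y) t
  · exact le_ciSup (bddAbove hF h0 x y') t

end zigzagEnvelope

end Tree

/-! ### Support functionals in directions of concavity -/

/-- Midpoint concavity and boundedness below give concavity on a segment: the infimum `m` of the
difference to the chord satisfies `m / 2 ≤ m`, since every point of `[0, 1]` is the midpoint of an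
end of the segment and another point of it. -/
theorem le_of_midpoint_concave {h : ℝ → ℝ} (hmid : ∀ s t, (h s + h t) / 2 ≤ h ((s + t) / 2))
    {c : ℝ} (hc : ∀ t ∈ Set.Icc (0 : ℝ) 1, c ≤ h t) {t : ℝ} (ht : t ∈ Set.Icc (0 : ℝ) 1) :
    (1 - t) * h 0 + t * h 1 ≤ h t := by
  set k : ℝ → ℝ := fun t => h t - ((1 - t) * h 0 + t * h 1) with hk
  have kmid : ∀ s t, (k s + k t) / 2 ≤ k ((s + t) / 2) := fun s t => by
    have := hmid s t
    simp only [hk]; linarith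
  have k0 : k 0 = 0 := by simp [hk]
  have k1 : k 1 = 0 := by simp [hk]
  have hbdd : BddBelow (k '' Set.Icc 0 1) := by
    refine ⟨c - (|h 0| + |h 1|), ?_⟩
    rintro _ ⟨s, hs, rfl⟩
    have h1 : (1 - s) * h 0 ≤ |h 0| :=
      (mul_le_mul_of_nonneg_left (le_abs_self _) (by linarith [hs.2])).trans
        (mul_le_of_le_one_left (abs_nonneg _) (by linarith [hs.1]))
    have h2 : s * h 1 ≤ |h 1| :=
      (mul_le_mul_of_nonneg_left (le_abs_self _) hs.1).trans
        (mul_le_of_le_one_left (abs_nonneg _) hs.2)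
    have := hc s hs
    simp only [hk]; linarith
  set m := sInf (k '' Set.Icc 0 1) with hm
  have hmle : ∀ s ∈ Set.Icc (0 : ℝ) 1, m ≤ k s := fun s hs => csInf_le hbdd ⟨s, hs, rfl⟩
  have hhalf : m / 2 ≤ m := by
    refine le_csInf ⟨_, 0, by simp, rfl⟩ ?_
    rintro _ ⟨s, hs, rfl⟩
    rcases le_total s (1 / 2) with h' | h'
    · have h1 := kmid 0 (2 * s)
      have h2 := hmle (2 * s) ⟨by linarith [hs.1], by linarith⟩
      rw [k0, show (0 + 2 * s) / 2 = s by ring] at h1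
      linarith
    · have h1 := kmid 1 (2 * s - 1)
      have h2 := hmle (2 * s - 1) ⟨by linarith, by linarith [hs.2]⟩
      rw [k1, show (1 + (2 * s - 1)) / 2 = s by ring] at h1
      linarith
  have := hmle t ht
  simp only [hk] at this
  linarith

section Support

variable {E : Type*} [NormedAddCommGroup E] [NormedSpace ℝ E]

/-- A function that is Lipschitz near `w` has at `w` a continuous linear functional which supports
it from above in all directions of concavity at once. The Clarke derivative
`η ↦ limsup (V (w' + t η) - V w') / t` of `V = -U`, for `w' → w` and `t ↓ 0`, is sublinear, and in
a direction `ξ` of convexity of `V` it is at most `V (w + ξ) - V w`; any linear functional below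
it will do. -/
theorem exists_support_of_lipschitz_near {U : E → ℝ} {w : E} {K : ℝ}
    (hK : ∀ᶠ q in 𝓝 w ×ˢ 𝓝 w, |U q.1 - U q.2| ≤ K * ‖q.1 - q.2‖) :
    ∃ L : E →L[ℝ] ℝ, ∀ ξ : E,
      (∀ w' : E, ∀ t ∈ Set.Icc (0 : ℝ) 1, (1 - t) * U w' + t * U (w' + ξ) ≤ U (w' + t • ξ)) →
      ContinuousAt U (w + ξ) → U (w + ξ) ≤ U w + L ξ := by
  set 𝓕 : Filter (E × ℝ) := 𝓝 w ×ˢ 𝓝[>] (0 : ℝ) with h𝓕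
  let Q : E → E × ℝ → ℝ := fun η q => (U q.1 - U (q.1 + q.2 • η)) / q.2
  let S : E → Set ℝ := fun η => {c | ∀ᶠ q in 𝓕, Q η q ≤ c}
  have tfst : Tendsto (fun q : E × ℝ => q.1) 𝓕 (𝓝 w) := tendsto_fst
  have tsnd : Tendsto (fun q : E × ℝ => q.2) 𝓕 (𝓝[>] (0 : ℝ)) := tendsto_snd
  have tsnd' : Tendsto (fun q : E × ℝ => q.2) 𝓕 (𝓝 (0 : ℝ)) := tsnd.mono_right nhdsWithin_le_nhds
  have tadd : ∀ η : E, Tendsto (fun q : E × ℝ => q.1 + q.2 • η) 𝓕 (𝓝 w) := fun η => by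
    simpa using tfst.add (tsnd'.smul_const η)
  have hpos : ∀ᶠ q in 𝓕, 0 < q.2 := tsnd self_mem_nhdsWithin
  have habs : ∀ η : E, ∀ᶠ q in 𝓕, |Q η q| ≤ K * ‖η‖ := fun η => by
    filter_upwards [hpos, (tfst.prodMk (tadd η)).eventually hK] with q h1 h2
    rw [abs_div, abs_of_pos h1, div_le_iff₀ h1]
    refine h2.trans_eq ?_
    simp [norm_smul, abs_of_pos h1]
    ring
  have hmem : ∀ η, K * ‖η‖ ∈ S η := fun η => (habs η).mono fun q h => (le_abs_self _).trans h
  have hlow : ∀ η, ∀ c ∈ S η, -(K * ‖η‖) ≤ c := fun η c hc => by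
    obtain ⟨q, h1, h2⟩ := ((habs η).and hc).exists
    linarith [neg_le_of_abs_le h1]
  have hbdd : ∀ η, BddBelow (S η) := fun η => ⟨_, hlow η⟩
  set N : E → ℝ := fun η => sInf (S η) with hN
  have Nadd : ∀ η η', N (η + η') ≤ N η + N η' := fun η η' => by
    have : ∀ a ∈ S η, ∀ b ∈ S η', N (η + η') ≤ a + b := fun a ha b hb => by
      refine csInf_le (hbdd _) (show ∀ᶠ q in 𝓕, Q (η + η') q ≤ a + b from ?_)
      have t1 : Tendsto (fun q : E × ℝ => (q.1 + q.2 • η', q.2)) 𝓕 𝓕 := (tadd η').prodMk tsnd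
      filter_upwards [t1.eventually ha, hb] with q h1 h2
      refine le_trans (le_of_eq ?_) (add_le_add h1 h2)
      simp only [Q, smul_add]
      rw [← add_div]
      congr 1
      rw [add_assoc, add_comm (q.2 • η')]
      ring
    rw [← sub_le_iff_le_add]
    refine le_csInf ⟨_, hmem η⟩ fun a ha => ?_
    rw [sub_le_comm]
    exact le_csInf ⟨_, hmem η'⟩ fun b hb => by linarith [this a ha b hb]
  have Nhom_le : ∀ c : ℝ, 0 < c → ∀ η, N (c • η) ≤ c * N η := fun c hc η => by
    rw [← div_le_iff₀' hc]
    refine le_csInf ⟨_, hmem η⟩ fun a ha => ?_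
    rw [div_le_iff₀' hc]
    refine csInf_le (hbdd _) (show ∀ᶠ q in 𝓕, Q (c • η) q ≤ c * a from ?_)
    have t1 : Tendsto (fun q : E × ℝ => (q.1, c * q.2)) 𝓕 𝓕 := by
      refine tfst.prodMk (tendsto_nhdsWithin_iff.2 ⟨by simpa using tsnd'.const_mul c, ?_⟩)
      exact hpos.mono fun q hq => mul_pos hc hq
    filter_upwards [t1.eventually ha, hpos] with q h1 h2
    simp only [Q] at h1 ⊢
    rw [div_le_iff₀ (by positivity)] at h1 ⊢
    rw [smul_smul, mul_comm q.2 c]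
    linarith
  have Nhom : ∀ c : ℝ, 0 < c → ∀ η, N (c • η) = c * N η := fun c hc η => by
    refine le_antisymm (Nhom_le c hc η) ?_
    have := Nhom_le c⁻¹ (inv_pos.2 hc) (c • η)
    rwa [smul_smul, inv_mul_cancel₀ hc.ne', one_smul, ← div_eq_inv_mul, le_div_iff₀' hc] at this
  have Nle : ∀ η, N η ≤ K * ‖η‖ := fun η => csInf_le (hbdd η) (hmem η)
  have N0 : N 0 = 0 := by
    have := Nhom 2 two_pos 0
    rw [smul_zero] at this; linarith
  obtain ⟨g, -, hg⟩ := exists_extension_of_le_sublinear (⊥ : E →ₗ.[ℝ] ℝ) N Nhom Nadd (by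
    rintro ⟨x, hx⟩
    have hx0 : x = 0 := (Submodule.mem_bot ℝ).1 hx
    subst hx0
    exact (LinearPMap.map_zero _).le.trans N0.ge)
  have hgK : ∀ η, ‖g η‖ ≤ K * ‖η‖ := fun η => by
    rw [Real.norm_eq_abs, abs_le]
    constructor
    · have := (hg (-η)).trans (Nle (-η))
      rw [map_neg, norm_neg] at this
      linarith
    · exact (hg η).trans (Nle η)
  refine ⟨-(g.mkContinuous K hgK), fun ξ hξ hcont => ?_⟩
  have hcw : ContinuousAt U w := by
    have h1 : Tendsto (fun x : E => (x, w)) (𝓝 w) (𝓝 w ×ˢ 𝓝 w) :=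
      tendsto_id.prodMk tendsto_const_nhds
    rw [ContinuousAt, tendsto_iff_norm_sub_tendsto_zero]
    have h2 : Tendsto (fun x : E => K * ‖x - w‖) (𝓝 w) (𝓝 0) := by
      have : Continuous fun x : E => K * ‖x - w‖ := by fun_prop
      simpa using this.tendsto w
    exact squeeze_zero' (Eventually.of_forall fun _ => norm_nonneg _) (h1.eventually hK) h2
  have hlim : Tendsto (fun q : E × ℝ => U q.1 - U (q.1 + ξ)) 𝓕 (𝓝 (U w - U (w + ξ))) :=
    (hcw.tendsto.comp tfst).sub (hcont.tendsto.comp (tfst.add_const ξ))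
  have hle : N ξ ≤ U w - U (w + ξ) := by
    refine le_of_forall_pos_le_add fun ε hε =>
      csInf_le (hbdd _) (show ∀ᶠ q in 𝓕, Q ξ q ≤ U w - U (w + ξ) + ε from ?_)
    have h1 : ∀ᶠ q in 𝓕, q.2 < 1 := tsnd' (Iio_mem_nhds one_pos)
    filter_upwards [hpos, h1, hlim.eventually (Iio_mem_nhds (lt_add_of_pos_right _ hε))]
      with q h1 h2 h3
    have h4 := hξ q.1 q.2 ⟨h1.le, h2.le⟩
    simp only [Q]
    rw [div_le_iff₀ h1]
    nlinarith
  have := (hg ξ).trans hle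
  simp only [neg_apply, LinearMap.mkContinuous_apply]
  linarith

end Support

/-! ### The envelope of the power payoff -/

section PowerPayoff

variable {𝕜 : Type u} [RCLike 𝕜] {X : Type v} [NormedAddCommGroup X] [NormedSpace 𝕜 X]

/-- The payoff `‖y‖ ^ p - β ^ p ‖x‖ ^ p`. -/
noncomputable def powerPayoff {X : Type v} [NormedAddCommGroup X] (p β : ℝ) (x y : X) : ℝ :=
  ‖y‖ ^ p - β ^ p * ‖x‖ ^ p

/-- The `L^p` estimate with constant `β` for dyadic martingales started at the origin, whose
unimodular multipliers may depend on the past. -/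
def ZigzagBound (𝕜 : Type u) [RCLike 𝕜] (X : Type v) [NormedAddCommGroup X] [NormedSpace 𝕜 X]
    (p β : ℝ) : Prop :=
  ∀ t : ZigzagTree 𝕜 X, t.val (powerPayoff p β) 0 0 ≤ 0

theorem powerPayoff_neg (p β : ℝ) (x y : X) : powerPayoff p β (-x) (-y) = powerPayoff p β x y := by
  simp [powerPayoff]

theorem convexOn_powerPayoff [NormedSpace ℝ X] {p : ℝ} (hp : 1 ≤ p) (β : ℝ) (x : X) :
    ConvexOn ℝ Set.univ (powerPayoff p β x) := by
  have h1 : ConvexOn ℝ Set.univ fun y : X => ‖y‖ ^ p := by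
    have h2 := (convexOn_rpow hp).subset (s := (fun y : X => ‖y‖) '' Set.univ)
      (by rintro _ ⟨y, -, rfl⟩; exact norm_nonneg y) ?_
    · exact h2.comp (convexOn_norm convex_univ) fun a ha b hb hab => by
        obtain ⟨y, -, rfl⟩ := ha
        exact Real.rpow_le_rpow (norm_nonneg _) hab (by linarith)
    · exact ((isPreconnected_univ.image _ continuous_norm.continuousOn).ordConnected).convex
  have := h1.add (convexOn_const (-(β ^ p * ‖x‖ ^ p)) convex_univ)
  exact this

variable {p β : ℝ}

local notation "𝓤" => zigzagEnvelope 𝕜 (powerPayoff (X := X) p β)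

theorem abs_envelope_le (hp : 1 ≤ p) (hβ : 0 ≤ β) (h0 : ZigzagBound 𝕜 X p β) (w : X × X) :
    |𝓤 w| ≤ β ^ p * ‖w‖ ^ p := by
  obtain ⟨x, y⟩ := w
  have hβp : 0 ≤ β ^ p := Real.rpow_nonneg hβ p
  have h1 : ‖y‖ ^ p - β ^ p * ‖x‖ ^ p ≤ 𝓤 (x, y) :=
    zigzagEnvelope.le_self (powerPayoff_neg p β) h0 x y
  have h2 : 𝓤 (x, y) ≤ -(‖x‖ ^ p - β ^ p * ‖y‖ ^ p) :=
    zigzagEnvelope.le_neg_swap (powerPayoff_neg p β) h0 x y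
  have hx : ‖x‖ ^ p ≤ ‖(x, y)‖ ^ p :=
    Real.rpow_le_rpow (norm_nonneg _) (norm_fst_le (x, y)) (by linarith)
  have hy : ‖y‖ ^ p ≤ ‖(x, y)‖ ^ p :=
    Real.rpow_le_rpow (norm_nonneg _) (norm_snd_le (x, y)) (by linarith)
  have hx0 : 0 ≤ ‖x‖ ^ p := by positivity
  have hy0 : 0 ≤ ‖y‖ ^ p := by positivity
  rw [abs_le]
  constructor <;> nlinarith

variable [NormedSpace ℝ X] [IsScalarTower ℝ 𝕜 X]

/-- Midpoint concavity becomes concavity, since the envelope is bounded on segments. -/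
theorem envelope_line_concave (hp : 1 ≤ p) (hβ : 0 ≤ β) (h0 : ZigzagBound 𝕜 X p β) (z : X) {e : 𝕜}
    (he : ‖e‖ = 1) (w : X × X) {t : ℝ} (ht : t ∈ Set.Icc (0 : ℝ) 1) :
    (1 - t) * 𝓤 w + t * 𝓤 (w + (z, e • z)) ≤ 𝓤 (w + t • (z, e • z)) := by
  have := le_of_midpoint_concave (h := fun t : ℝ => 𝓤 (w + t • (z, e • z)))
    (c := -(β ^ p * (‖w‖ + ‖(z, e • z)‖) ^ p)) ?_ ?_ ht
  · simpa using this
  · intro s t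
    have h1 := zigzagEnvelope.midpoint (powerPayoff_neg p β) h0
      (w + ((s + t) / 2) • (z, e • z)) (((s - t) / 2) • z) he
    have h2 : (((s - t) / 2) • z, e • ((s - t) / 2) • z) = ((s - t) / 2) • (z, e • z) := by
      rw [Prod.smul_mk, smul_comm]
    rw [h2, add_assoc, ← add_smul, add_sub_assoc, ← sub_smul] at h1
    convert h1 using 6 <;> ring
  · intro t ht
    refine neg_le_of_abs_le ((abs_envelope_le hp hβ h0 _).trans ?_)
    gcongr
    refine (norm_add_le _ _).trans ?_
    gcongr
    rw [norm_smul]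
    refine mul_le_of_le_one_left (norm_nonneg _) ?_
    rw [Real.norm_eq_abs, abs_of_nonneg ht.1]
    exact ht.2

theorem envelope_lipschitz_line (hp : 1 ≤ p) (hβ : 0 ≤ β) (h0 : ZigzagBound 𝕜 X p β) {R : ℝ}
    {w : X × X} (hw : ‖w‖ ≤ R) (z : X) {e : 𝕜} (he : ‖e‖ = 1) (hz : ‖z‖ ≤ 1) :
    |𝓤 (w + (z, e • z)) - 𝓤 w| ≤ 2 * (β ^ p * (R + 2) ^ p) * ‖z‖ := by
  have hR : 0 ≤ R := (norm_nonneg _).trans hw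
  have hnorm : ∀ z : X, ‖(z, e • z)‖ = ‖z‖ := fun z => by simp [Prod.norm_def, norm_smul, he]
  have hb : ∀ v : X × X, ‖v‖ ≤ R + 2 → |𝓤 v| ≤ β ^ p * (R + 2) ^ p := fun v hv =>
    (abs_envelope_le hp hβ h0 v).trans (by gcongr)
  have key : ∀ (w : X × X) (z : X), ‖w‖ ≤ R + 1 → ‖z‖ ≤ 1 →
      𝓤 w - 𝓤 (w + (z, e • z)) ≤ 2 * (β ^ p * (R + 2) ^ p) * ‖z‖ := fun w z hw hz => by
    rcases eq_or_ne z 0 with rfl | hz0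
    · rw [smul_zero, Prod.mk_zero_zero, add_zero]
      simp
    have hz0' : 0 < ‖z‖ := norm_pos_iff.2 hz0
    have h1 := envelope_line_concave hp hβ h0 (‖z‖⁻¹ • z) he w (t := ‖z‖) ⟨hz0'.le, hz⟩
    rw [smul_comm e, ← Prod.smul_mk, smul_smul, mul_inv_cancel₀ hz0'.ne', one_smul] at h1
    have h2 := abs_le.1 (hb (w + ‖z‖⁻¹ • (z, e • z)) (by
      refine (norm_add_le _ _).trans ?_
      rw [norm_smul, hnorm, norm_inv, norm_norm, inv_mul_cancel₀ hz0'.ne']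
      linarith))
    have h3 := abs_le.1 (hb w (by linarith))
    nlinarith
  rw [abs_le]
  constructor
  · linarith [key w z (by linarith) hz]
  · have := key (w + (z, e • z)) (-z) ((norm_add_le _ _).trans (by rw [hnorm]; linarith))
      (by rwa [norm_neg])
    rw [smul_neg, ← Prod.neg_mk, add_neg_cancel_right, norm_neg] at this
    linarith

/-- A locally bounded function that is concave in the directions `(a, a)` and `(b, -b)` is locally
Lipschitz, as every vector is a sum of two such ones. -/
theorem envelope_lipschitz_near (hp : 1 ≤ p) (hβ : 0 ≤ β) (h0 : ZigzagBound 𝕜 X p β) (w : X × X) :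
    ∃ K : ℝ, ∀ᶠ q in 𝓝 w ×ˢ 𝓝 w, |𝓤 q.1 - 𝓤 q.2| ≤ K * ‖q.1 - q.2‖ := by
  set R := ‖w‖ + 1 + 1 with hR
  set K := 2 * (β ^ p * (R + 2) ^ p) with hK
  have hK0 : 0 ≤ K := by positivity
  refine ⟨K + K, ?_⟩
  have hball : Metric.ball w (1 / 2) ∈ 𝓝 w := Metric.ball_mem_nhds _ (by norm_num)
  filter_upwards [prod_mem_prod hball hball] with q hq
  have hq1 : ‖q.1 - w‖ < 1 / 2 := mem_ball_iff_norm.1 hq.1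
  have hq2 : ‖q.2 - w‖ < 1 / 2 := mem_ball_iff_norm.1 hq.2
  have hq12 : ‖q.1 - q.2‖ ≤ 1 := by
    have := norm_sub_le (q.1 - w) (q.2 - w)
    rw [sub_sub_sub_cancel_right] at this
    linarith
  have hq2' : ‖q.2‖ ≤ ‖w‖ + 1 := by
    have := norm_add_le (q.2 - w) w
    rw [sub_add_cancel] at this
    linarith
  -- `q.1 - q.2 = (a, a) + (b, -b)`
  set δ := q.1 - q.2 with hδ
  set a : X := (1 / 2 : ℝ) • (δ.1 + δ.2) with ha
  set b : X := (1 / 2 : ℝ) • (δ.1 - δ.2) with hb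
  have half : ∀ x y : X, ‖x‖ ≤ ‖δ‖ → ‖y‖ ≤ ‖δ‖ → ‖(1 / 2 : ℝ) • (x + y)‖ ≤ ‖δ‖ :=
    fun x y hx hy => by
      rw [norm_smul]
      have := norm_add_le x y
      norm_num
      linarith
  have ha' : ‖a‖ ≤ ‖δ‖ := half _ _ (norm_fst_le δ) (norm_snd_le δ)
  have hb' : ‖b‖ ≤ ‖δ‖ := by
    rw [hb, sub_eq_add_neg]
    exact half _ _ (norm_fst_le δ) (by rw [norm_neg]; exact norm_snd_le δ)
  have hab : q.1 = q.2 + (a, (1 : 𝕜) • a) + (b, (-1 : 𝕜) • b) := by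
    have e1 : a + b = δ.1 := by
      rw [ha, hb, ← smul_add, add_add_sub_cancel, ← two_smul ℝ, smul_smul]; norm_num
    have e2 : a - b = δ.2 := by
      rw [ha, hb, ← smul_sub, show δ.1 + δ.2 - (δ.1 - δ.2) = δ.2 + δ.2 by abel, ← two_smul ℝ,
        smul_smul]
      norm_num
    have e3 : (a, (1 : 𝕜) • a) + (b, (-1 : 𝕜) • b) = δ := by
      refine Prod.ext e1 ?_
      simpa [sub_eq_add_neg] using e2
    rw [add_assoc, e3, hδ, add_sub_cancel]
  have h1 := envelope_lipschitz_line hp hβ h0 (R := R) (w := q.2) (by linarith) a (e := 1)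
    (by simp) (ha'.trans hq12)
  have h2 := envelope_lipschitz_line hp hβ h0 (R := R) (w := q.2 + (a, (1 : 𝕜) • a))
    (by
      refine (norm_add_le _ _).trans ?_
      have : ‖(a, (1 : 𝕜) • a)‖ ≤ 1 := by simpa [Prod.norm_def] using ha'.trans hq12
      linarith) b (e := -1) (by simp) (hb'.trans hq12)
  rw [← hab] at h2
  rw [← hK] at h1 h2
  calc |𝓤 q.1 - 𝓤 q.2| ≤ _ := abs_sub_le _ (𝓤 (q.2 + (a, (1 : 𝕜) • a))) _
    _ ≤ K * ‖b‖ + K * ‖a‖ := add_le_add h2 h1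
    _ ≤ (K + K) * ‖δ‖ := by nlinarith

theorem continuous_envelope (hp : 1 ≤ p) (hβ : 0 ≤ β) (h0 : ZigzagBound 𝕜 X p β) :
    Continuous 𝓤 := by
  refine continuous_iff_continuousAt.2 fun w => ?_
  obtain ⟨K, hK⟩ := envelope_lipschitz_near hp hβ h0 w
  have h1 : Tendsto (fun x : X × X => (x, w)) (𝓝 w) (𝓝 w ×ˢ 𝓝 w) :=
    tendsto_id.prodMk tendsto_const_nhds
  rw [ContinuousAt, tendsto_iff_norm_sub_tendsto_zero]
  have h2 : Tendsto (fun x : X × X => K * ‖x - w‖) (𝓝 w) (𝓝 0) := by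
    have : Continuous fun x : X × X => K * ‖x - w‖ := by fun_prop
    simpa using this.tendsto w
  exact squeeze_zero' (Eventually.of_forall fun _ => norm_nonneg _) (h1.eventually hK) h2

/-- The envelope is supported from above at each point by a linear functional, simultaneously in
all directions `(z, a • z)` with `|a| ≤ 1`. For `|a| = 1` the envelope is concave in these
directions; the other `a` are convex combinations of `e` and `-e` with `|e| = 1`, and the envelope
is convex in the second variable. -/
theorem exists_support_envelope (hp : 1 ≤ p) (hβ : 0 ≤ β) (h0 : ZigzagBound 𝕜 X p β) (w : X × X) :
    ∃ L : X × X →L[ℝ] ℝ, ∀ (z : X) (a : 𝕜), ‖a‖ ≤ 1 →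
      𝓤 (w + (z, a • z)) ≤ 𝓤 w + L (z, a • z) := by
  obtain ⟨K, hK⟩ := envelope_lipschitz_near hp hβ h0 w
  obtain ⟨L, hL⟩ := exists_support_of_lipschitz_near hK
  have hL1 : ∀ (z : X) (e : 𝕜), ‖e‖ = 1 → 𝓤 (w + (z, e • z)) ≤ 𝓤 w + L (z, e • z) :=
    fun z e he => hL _ (fun w' t ht => envelope_line_concave hp hβ h0 z he w' ht)
      (continuous_envelope hp hβ h0).continuousAt
  refine ⟨L, fun z a ha => ?_⟩
  obtain ⟨e, he, hae⟩ : ∃ e : 𝕜, ‖e‖ = 1 ∧ a = (‖a‖ : ℝ) • e := by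
    rcases eq_or_ne a 0 with rfl | ha0
    · exact ⟨1, by simp, by simp⟩
    · refine ⟨(‖a‖⁻¹ : ℝ) • a, ?_, ?_⟩
      · rw [norm_smul, norm_inv, norm_norm, inv_mul_cancel₀ (norm_ne_zero_iff.2 ha0)]
      · rw [smul_smul, mul_inv_cancel₀ (norm_ne_zero_iff.2 ha0), one_smul]
  set s := (1 + ‖a‖) / 2 with hs
  have haz : a • z = s • (e • z) + (1 - s) • ((-e) • z) := by
    rw [neg_smul, smul_neg, ← sub_eq_add_neg, ← sub_smul, hs,
      show (1 + ‖a‖) / 2 - (1 - (1 + ‖a‖) / 2) = ‖a‖ by ring, ← smul_assoc, ← hae]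
  have hs0 : 0 ≤ s := by positivity
  have hs1 : 0 ≤ 1 - s := by rw [hs]; linarith
  have hsum : s + (1 - s) = 1 := by ring
  have hconv := (zigzagEnvelope.convexOn_snd (𝕜 := 𝕜) (powerPayoff_neg p β) h0
    (convexOn_powerPayoff hp β) (w.1 + z)).2 (Set.mem_univ (w.2 + e • z))
    (Set.mem_univ (w.2 + (-e) • z)) hs0 hs1 hsum
  have e1 : s • (w.2 + e • z) + (1 - s) • (w.2 + (-e) • z) = w.2 + a • z := by
    rw [haz, smul_add, smul_add, add_add_add_comm, ← add_smul, hsum, one_smul]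
  have e2 : (z, a • z) = s • (z, e • z) + (1 - s) • (z, (-e) • z) := by
    rw [Prod.smul_mk, Prod.smul_mk, Prod.mk_add_mk, ← haz, ← add_smul, hsum, one_smul]
  rw [e1] at hconv
  have h1 := hL1 z e he
  have h2 := hL1 z (-e) (by rwa [norm_neg])
  calc 𝓤 (w + (z, a • z)) ≤ s * 𝓤 (w + (z, e • z)) + (1 - s) * 𝓤 (w + (z, (-e) • z)) := hconv
    _ ≤ s * (𝓤 w + L (z, e • z)) + (1 - s) * (𝓤 w + L (z, (-e) • z)) := by gcongr
    _ = 𝓤 w + L (z, a • z) := by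
      rw [e2, map_add, map_smul, map_smul, smul_eq_mul, smul_eq_mul]; ring

end PowerPayoff

/-! ### Transforms of martingale differences -/

section Increment

variable {Ω E : Type*} [NormedAddCommGroup E]

theorem exists_simpleFunc_approx {m : MeasurableSpace Ω} {f : Ω → E} (hf : StronglyMeasurable f) :
    ∃ s : ℕ → SimpleFunc Ω E, (∀ ω, Tendsto (fun n => s n ω) atTop (𝓝 (f ω))) ∧
      ∀ n ω, ‖s n ω‖ ≤ ‖f ω‖ + ‖f ω‖ := by
  borelize E
  have : TopologicalSpace.SeparableSpace (Set.range f ∪ {0} : Set E) :=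
    hf.separableSpace_range_union_singleton
  exact ⟨SimpleFunc.approxOn f hf.measurable (Set.range f ∪ {0}) 0 (by simp),
    fun ω => SimpleFunc.tendsto_approxOn _ _ (subset_closure (Or.inl ⟨ω, rfl⟩)),
    fun n ω => SimpleFunc.norm_approxOn_zero_le _ _ ω n⟩

variable [NormedSpace ℝ E] [CompleteSpace E] {m' m : MeasurableSpace Ω} {μ : Measure Ω}
  [IsProbabilityMeasure μ]

/-- Jensen's inequality at a random base point `W`, for a function `U` that has at every point `w`
a linear support valid along the increment `ξ`. For a simple `W` the estimate is integrated over
the sets where `W` is constant; a general `W` is approximated, so that no measurable choice of the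
support functionals is needed. -/
theorem integral_comp_add_le {U : E → ℝ} (hU : Continuous U) {C p : ℝ} (hC : 0 ≤ C) (hp : 1 ≤ p)
    (hUC : ∀ w, |U w| ≤ C * ‖w‖ ^ p) (hm : m' ≤ m) {W ξ : Ω → E}
    (hW : StronglyMeasurable[m'] W) (hWp : MemLp W (ENNReal.ofReal p) μ)
    (hξp : MemLp ξ (ENNReal.ofReal p) μ)
    (hξ : ∀ A, MeasurableSet[m'] A → ∫ ω in A, ξ ω ∂μ = 0)
    (hsupp : ∀ w, ∃ L : E →L[ℝ] ℝ, ∀ᵐ ω ∂μ, U (w + ξ ω) ≤ U w + L (ξ ω)) :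
    ∫ ω, U (W ω + ξ ω) ∂μ ≤ ∫ ω, U (W ω) ∂μ := by
  have hp0 : 0 < p := by linarith
  have hp1 : 1 ≤ ENNReal.ofReal p := by simpa using ENNReal.ofReal_le_ofReal hp
  have hξi : Integrable ξ μ := hξp.integrable hp1
  obtain ⟨s, hs, hsb⟩ := exists_simpleFunc_approx hW
  set b : Ω → ℝ := fun ω => ‖W ω‖ + ‖W ω‖ + ‖ξ ω‖ with hb
  have hbp : MemLp b (ENNReal.ofReal p) μ := (hWp.norm.add hWp.norm).add hξp.norm
  have hbi : Integrable (fun ω => C * b ω ^ p) μ := by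
    have := hbp.integrable_norm_rpow (by simpa using hp0) ENNReal.ofReal_ne_top
    rw [ENNReal.toReal_ofReal hp0.le] at this
    refine (this.congr (ae_of_all _ fun ω => ?_)).const_mul C
    simp only
    rw [Real.norm_of_nonneg (by positivity)]
  have hdom : ∀ (v : E) ω, ‖v‖ ≤ b ω → ‖U v‖ ≤ C * b ω ^ p := fun v ω hv =>
    (hUC v).trans (by gcongr)
  have hsm : ∀ n, StronglyMeasurable (s n) := fun n => ((s n).stronglyMeasurable).mono hm
  have hb1 : ∀ n ω, ‖s n ω + ξ ω‖ ≤ b ω := fun n ω =>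
    (norm_add_le _ _).trans (by simp only [hb]; linarith [hsb n ω])
  have hb2 : ∀ n ω, ‖s n ω‖ ≤ b ω := fun n ω =>
    (hsb n ω).trans (by simp only [hb]; linarith [norm_nonneg (ξ ω)])
  have hm1 : ∀ n, AEStronglyMeasurable (fun ω => U (s n ω + ξ ω)) μ := fun n =>
    hU.comp_aestronglyMeasurable ((hsm n).aestronglyMeasurable.add hξi.aestronglyMeasurable)
  have hm2 : ∀ n, AEStronglyMeasurable (fun ω => U (s n ω)) μ := fun n =>
    hU.comp_aestronglyMeasurable (hsm n).aestronglyMeasurable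
  have hi1 : ∀ n, Integrable (fun ω => U (s n ω + ξ ω)) μ := fun n =>
    hbi.mono' (hm1 n) (ae_of_all _ fun ω => hdom _ _ (hb1 n ω))
  have hi2 : ∀ n, Integrable (fun ω => U (s n ω)) μ := fun n =>
    hbi.mono' (hm2 n) (ae_of_all _ fun ω => hdom _ _ (hb2 n ω))
  refine le_of_tendsto_of_tendsto'
    (tendsto_integral_of_dominated_convergence _ hm1 hbi
      (fun n => ae_of_all _ fun ω => hdom _ _ (hb1 n ω))
      (ae_of_all _ fun ω => (hU.tendsto _).comp ((hs ω).add_const (ξ ω))))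
    (tendsto_integral_of_dominated_convergence _ hm2 hbi
      (fun n => ae_of_all _ fun ω => hdom _ _ (hb2 n ω))
      (ae_of_all _ fun ω => (hU.tendsto _).comp (hs ω))) fun n => ?_
  have hA : ∀ w, MeasurableSet (s n ⁻¹' {w}) := fun w =>
    hm _ (@SimpleFunc.measurableSet_fiber Ω E m' (s n) w)
  have hcov : ⋃ w ∈ (@SimpleFunc.range Ω E m' (s n)), s n ⁻¹' {w} = Set.univ := by
    ext ω; simp [@SimpleFunc.mem_range Ω E m']
  have hdisj : Set.Pairwise (↑(@SimpleFunc.range Ω E m' (s n)))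
      (Function.onFun Disjoint fun w => s n ⁻¹' {w}) :=
    fun a _ b _ hab => Disjoint.preimage _ (by simpa using hab)
  rw [← setIntegral_univ (f := fun ω => U (s n ω + ξ ω)),
    ← setIntegral_univ (f := fun ω => U (s n ω)),
    ← hcov, integral_biUnion_finset _ (fun w _ => hA w) hdisj fun w _ => (hi1 n).integrableOn,
    integral_biUnion_finset _ (fun w _ => hA w) hdisj fun w _ => (hi2 n).integrableOn]
  refine Finset.sum_le_sum fun w _ => ?_
  obtain ⟨L, hL⟩ := hsupp w
  have hLi : Integrable (fun ω => L (ξ ω)) μ := L.integrable_comp hξi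
  calc ∫ ω in s n ⁻¹' {w}, U (s n ω + ξ ω) ∂μ
      ≤ ∫ ω in s n ⁻¹' {w}, (U (s n ω) + L (ξ ω)) ∂μ := by
        refine setIntegral_mono_on_ae (hi1 n).integrableOn ((hi2 n).add hLi).integrableOn (hA w) ?_
        filter_upwards [hL] with ω hω hωA
        rw [show s n ω = w from hωA]
        exact hω
    _ = ∫ ω in s n ⁻¹' {w}, U (s n ω) ∂μ + L (∫ ω in s n ⁻¹' {w}, ξ ω ∂μ) := by
        rw [integral_add (hi2 n).integrableOn hLi.integrableOn,
          L.integral_comp_comm hξi.integrableOn]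
    _ = ∫ ω in s n ⁻¹' {w}, U (s n ω) ∂μ := by
        rw [hξ _ (@SimpleFunc.measurableSet_fiber Ω E m' (s n) w), map_zero, add_zero]

end Increment

section Transform

variable {𝕜 : Type u} [RCLike 𝕜] {X : Type v} [NormedAddCommGroup X] [NormedSpace 𝕜 X]
  [NormedSpace ℝ X] [IsScalarTower ℝ 𝕜 X] [CompleteSpace X] {p β : ℝ}

/-- The first `n` terms of `d` and `e` are martingale differences (with arbitrary first terms), and
`e k = a k • d k` with scalars of modulus at most `1`. -/
structure IsTransformUpTo (𝕜 : Type u) [RCLike 𝕜] {X : Type v} [NormedAddCommGroup X]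
    [NormedSpace 𝕜 X] [NormedSpace ℝ X] {Ω : Type*} {m : MeasurableSpace Ω} (e d : ℕ → Ω → X)
    (ℱ : Filtration ℕ m) (μ : Measure Ω) (n : ℕ) : Prop where
  adapted : ∀ k < n, StronglyMeasurable[ℱ k] (d k)
  adapted' : ∀ k < n, StronglyMeasurable[ℱ k] (e k)
  setIntegral_succ : ∀ k, k + 1 < n → ∀ A, MeasurableSet[ℱ k] A → ∫ ω in A, d (k + 1) ω ∂μ = 0
  setIntegral_succ' : ∀ k, k + 1 < n → ∀ A, MeasurableSet[ℱ k] A → ∫ ω in A, e (k + 1) ω ∂μ = 0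
  exists_smul : ∀ k < n, ∀ᵐ ω ∂μ, ∃ a : 𝕜, ‖a‖ ≤ 1 ∧ e k ω = a • d k ω

local notation "𝓤" => zigzagEnvelope 𝕜 (powerPayoff (X := X) p β)

omit [NormedSpace ℝ X] [CompleteSpace X] in
theorem ofReal_norm_rpow (hp : 0 ≤ p) (x : X) : ENNReal.ofReal (‖x‖ ^ p) = ‖x‖ₑ ^ p := by
  rw [← ENNReal.ofReal_rpow_of_nonneg (norm_nonneg _) hp, ofReal_norm]

/-- The transfer of the `L^p` estimate from dyadic martingales to arbitrary ones: the expectation of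
the envelope along the pair of martingales decreases, and it starts with a nonpositive value. -/
theorem IsTransformUpTo.lintegral_le {Ω : Type*} {m : MeasurableSpace Ω} {μ : Measure Ω}
    [IsProbabilityMeasure μ] {ℱ : Filtration ℕ m} {d e : ℕ → Ω → X} {n : ℕ}
    (h : IsTransformUpTo 𝕜 e d ℱ μ n) (hp : 1 ≤ p) (hβ : 0 ≤ β) (h0 : ZigzagBound 𝕜 X p β)
    (hd : ∀ k < n, MemLp (d k) (ENNReal.ofReal p) μ) :
    ∫⁻ ω, ‖∑ k ∈ Finset.range n, e k ω‖ₑ ^ p ∂μ ≤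
      ENNReal.ofReal β ^ p * ∫⁻ ω, ‖∑ k ∈ Finset.range n, d k ω‖ₑ ^ p ∂μ := by
  have hp0 : 0 < p := by linarith
  have hp1 : 1 ≤ ENNReal.ofReal p := by simpa using ENNReal.ofReal_le_ofReal hp
  have hβp : 0 ≤ β ^ p := Real.rpow_nonneg hβ p
  have hU := continuous_envelope (𝕜 := 𝕜) hp hβ h0
  have hUle := abs_envelope_le (𝕜 := 𝕜) hp hβ h0
  have he : ∀ k < n, MemLp (e k) (ENNReal.ofReal p) μ := fun k hk => by
    refine (hd k hk).mono (((h.adapted' k hk).mono (ℱ.le k)).aestronglyMeasurable) ?_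
    filter_upwards [h.exists_smul k hk] with ω ⟨a, ha, hae⟩
    rw [hae, norm_smul]
    exact mul_le_of_le_one_left (norm_nonneg _) ha
  set W : ℕ → Ω → X × X := fun k ω => (∑ j ∈ Finset.range k, d j ω, ∑ j ∈ Finset.range k, e j ω)
    with hW
  have hWp : ∀ k ≤ n, MemLp (W k) (ENNReal.ofReal p) μ := fun k hk =>
    memLp_prod_iff.2
      ⟨memLp_finsetSum _ fun j hj => hd j ((Finset.mem_range.1 hj).trans_le hk),
        memLp_finsetSum _ fun j hj => he j ((Finset.mem_range.1 hj).trans_le hk)⟩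
  have hWsucc : ∀ k ω, W (k + 1) ω = W k ω + (d k ω, e k ω) := fun k ω => by
    simp only [hW, Finset.sum_range_succ, Prod.mk_add_mk]
  have key : ∀ k ≤ n, ∫ ω, 𝓤 (W k ω) ∂μ ≤ 0 := by
    intro k
    induction k with
    | zero =>
      intro _
      simpa [hW] using zigzagEnvelope.zero_le (𝕜 := 𝕜) h0
    | succ k ih =>
      intro hk
      have hk' : k < n := hk
      rcases Nat.eq_zero_or_pos k with rfl | hkpos
      -- the first difference need not have mean zero; here the evenness of the envelope is used
      · refine integral_nonpos_of_ae ?_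
        obtain ⟨L, hL⟩ := exists_support_envelope (𝕜 := 𝕜) hp hβ h0 (0 : X × X)
        filter_upwards [h.exists_smul 0 hk'] with ω ⟨a, ha, hae⟩
        have h1 := hL (d 0 ω) a ha
        have h2 := hL (-d 0 ω) a ha
        rw [smul_neg, ← Prod.neg_mk, map_neg, zero_add,
          zigzagEnvelope.neg_apply (powerPayoff_neg p β) h0] at h2
        rw [zero_add] at h1
        have h3 := zigzagEnvelope.zero_le (𝕜 := 𝕜) h0
        rw [Prod.mk_zero_zero] at h3
        rw [hWsucc, hae]
        simp only [hW, Finset.range_zero, Finset.sum_empty, Prod.mk_zero_zero, zero_add,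
          Pi.zero_apply]
        linarith
      · obtain ⟨j, rfl⟩ : ∃ j, k = j + 1 := ⟨k - 1, by omega⟩
        refine le_trans ?_ (ih hk'.le)
        simp_rw [hWsucc (j + 1)]
        refine integral_comp_add_le hU hβp hp hUle (ℱ.le j) ?_ (hWp _ hk'.le)
          (memLp_prod_iff.2 ⟨hd _ hk', he _ hk'⟩) (fun A hA => ?_) fun w => ?_
        · refine StronglyMeasurable.prodMk ?_ ?_
          · exact Finset.stronglyMeasurable_fun_sum _ fun i hi =>
              (h.adapted i (by rw [Finset.mem_range] at hi; omega)).mono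
                (ℱ.mono (by rw [Finset.mem_range] at hi; omega))
          · exact Finset.stronglyMeasurable_fun_sum _ fun i hi =>
              (h.adapted' i (by rw [Finset.mem_range] at hi; omega)).mono
                (ℱ.mono (by rw [Finset.mem_range] at hi; omega))
        · rw [integral_pair ((hd _ hk').integrable hp1).integrableOn
            ((he _ hk').integrable hp1).integrableOn, h.setIntegral_succ j hk' A hA,
            h.setIntegral_succ' j hk' A hA, Prod.mk_zero_zero]
        · obtain ⟨L, hL⟩ := exists_support_envelope (𝕜 := 𝕜) hp hβ h0 w
          refine ⟨L, ?_⟩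
          filter_upwards [h.exists_smul _ hk'] with ω ⟨a, ha, hae⟩
          rw [hae]
          exact hL _ a ha
  have hpow : ∀ f : Ω → X, MemLp f (ENNReal.ofReal p) μ →
      Integrable (fun ω => ‖f ω‖ ^ p) μ := fun f hf => by
    have := hf.integrable_norm_rpow (by simpa using hp0) ENNReal.ofReal_ne_top
    rwa [ENNReal.toReal_ofReal hp0.le] at this
  have hf := hpow _ (hWp n le_rfl).fst
  have hg := hpow _ (hWp n le_rfl).snd
  have hUi : Integrable (fun ω => 𝓤 (W n ω)) μ := by
    have := (hWp n le_rfl).integrable_norm_rpow (by simpa using hp0) ENNReal.ofReal_ne_top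
    rw [ENNReal.toReal_ofReal hp0.le] at this
    exact (this.const_mul (β ^ p)).mono'
      (hU.comp_aestronglyMeasurable (hWp n le_rfl).aestronglyMeasurable)
      (ae_of_all _ fun ω => hUle _)
  have hfin : ∫ ω, ‖(W n ω).2‖ ^ p ∂μ ≤ β ^ p * ∫ ω, ‖(W n ω).1‖ ^ p ∂μ := by
    have h1 : ∫ ω, (‖(W n ω).2‖ ^ p - β ^ p * ‖(W n ω).1‖ ^ p) ∂μ ≤ ∫ ω, 𝓤 (W n ω) ∂μ :=
      integral_mono (hg.sub (hf.const_mul _)) hUi fun ω =>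
        zigzagEnvelope.le_self (powerPayoff_neg p β) h0 (W n ω).1 (W n ω).2
    rw [integral_sub hg (hf.const_mul _), integral_const_mul] at h1
    linarith [key n le_rfl]
  have := ENNReal.ofReal_le_ofReal hfin
  rw [ENNReal.ofReal_mul hβp,
    ofReal_integral_eq_lintegral_ofReal hg (ae_of_all _ fun ω => by positivity),
    ofReal_integral_eq_lintegral_ofReal hf (ae_of_all _ fun ω => by positivity),
    ← ENNReal.ofReal_rpow_of_nonneg hβ hp0.le] at this
  simpa only [ofReal_norm_rpow hp0.le, hW] using this

end Transform

/-! ### From martingale differences on coin spaces to strategies -/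

namespace ZigzagTree

variable {𝕜 : Type u} [RCLike 𝕜] {X : Type v} [NormedAddCommGroup X] [NormedSpace 𝕜 X]

/-- The maximal number of coin tosses. -/
def depth : ZigzagTree 𝕜 X → ℕ
  | leaf => 0
  | node _ _ l r => max l.depth r.depth + 1

/-- The multiplier at step `k` is `ε k`, whatever the past. -/
def IsUniform : ZigzagTree 𝕜 X → (ℕ → Metric.sphere (0 : 𝕜) 1) → Prop
  | leaf, _ => True
  | node _ e l r, ε => ε 0 = e ∧ l.IsUniform (fun k => ε (k + 1)) ∧ r.IsUniform (fun k => ε (k + 1))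

/-- The strategy `t` preceded by `n` steps of size zero, with multipliers `ε 0, …, ε (n - 1)`. -/
def delay (t : ZigzagTree 𝕜 X) : ℕ → (ℕ → Metric.sphere (0 : 𝕜) 1) → ZigzagTree 𝕜 X
  | 0, _ => t
  | n + 1, ε => node 0 (ε 0) (delay t n fun k => ε (k + 1)) (delay t n fun k => ε (k + 1))

theorem val_delay (F : X → X → ℝ) (t : ZigzagTree 𝕜 X) (n : ℕ)
    (ε : ℕ → Metric.sphere (0 : 𝕜) 1) (x y : X) : (t.delay n ε).val F x y = t.val F x y := by
  induction n generalizing ε with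
  | zero => rfl
  | succ n ih => simp [delay, val, ih]

omit [NormedSpace 𝕜 X] in
theorem IsUniform.delay {t : ZigzagTree 𝕜 X} {n : ℕ} {ε : ℕ → Metric.sphere (0 : 𝕜) 1}
    (h : t.IsUniform fun k => ε (k + n)) : (t.delay n ε).IsUniform ε := by
  induction n generalizing ε with
  | zero => exact h
  | succ n ih =>
    have := ih (ε := fun k => ε (k + 1)) (by simpa [add_assoc] using h)
    exact ⟨rfl, this, this⟩

omit [NormedAddCommGroup X] [NormedSpace 𝕜 X] in
theorem IsUniform.congr {t : ZigzagTree 𝕜 X} {ε ε' : ℕ → Metric.sphere (0 : 𝕜) 1}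
    (h : t.IsUniform ε) (hε : ∀ k < t.depth, ε k = ε' k) : t.IsUniform ε' := by
  induction t generalizing ε ε' with
  | leaf => trivial
  | node z e l r hl hr =>
    refine ⟨(hε 0 (by simp [depth])).symm.trans h.1, hl h.2.1 fun k hk => hε _ ?_,
      hr h.2.2 fun k hk => hε _ ?_⟩
    · simp only [depth]; omega
    · simp only [depth]; omega

/-- Every strategy has the same values as a strategy with deterministic multipliers: the steps of
the two branches are carried out one after the other. -/
theorem exists_isUniform (t : ZigzagTree 𝕜 X) :
    ∃ (t' : ZigzagTree 𝕜 X) (ε : ℕ → Metric.sphere (0 : 𝕜) 1), t'.IsUniform ε ∧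
      ∀ (F : X → X → ℝ) (x y : X), t'.val F x y = t.val F x y := by
  induction t with
  | leaf => exact ⟨leaf, fun _ => ⟨1, by simp⟩, trivial, fun _ _ _ => rfl⟩
  | node z e l r hl hr =>
    obtain ⟨l', ε₁, hl', hlv⟩ := hl
    obtain ⟨r', ε₂, hr', hrv⟩ := hr
    set ε : ℕ → Metric.sphere (0 : 𝕜) 1 := fun k =>
      if k < l'.depth then ε₁ k else ε₂ (k - l'.depth) with hε
    refine ⟨node z e l' (r'.delay l'.depth ε), fun k => Nat.casesOn k e ε, ⟨rfl, ?_, ?_⟩, ?_⟩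
    · exact hl'.congr fun k hk => by simp [hε, hk]
    · refine IsUniform.delay (n := l'.depth) (ε := ε) ?_
      simpa [hε] using hr'
    · intro F x y
      simp [val, val_delay, hlv, hrv]

/-- The increment at step `k` along the coin tosses `ω`. -/
def inc : ZigzagTree 𝕜 X → ℕ → (ℕ → Bool) → X
  | leaf, _, _ => 0
  | node z _ _ _, 0, ω => if ω 0 then z else -z
  | node _ _ l r, k + 1, ω =>
    if ω 0 then l.inc k (fun i => ω (i + 1)) else r.inc k (fun i => ω (i + 1))

omit [NormedSpace 𝕜 X] in
theorem inc_congr (t : ZigzagTree 𝕜 X) (k : ℕ) {ω ω' : ℕ → Bool} (h : ∀ i ≤ k, ω i = ω' i) :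
    t.inc k ω = t.inc k ω' := by
  induction t generalizing k ω ω' with
  | leaf => rfl
  | node z e l r hl hr =>
    cases k with
    | zero => simp only [inc, h 0 le_rfl]
    | succ k =>
      have h' : ∀ i ≤ k, ω (i + 1) = ω' (i + 1) := fun i hi => h _ (by omega)
      simp only [inc, h 0 (by omega), hl k h', hr k h']

omit [NormedSpace 𝕜 X] in
theorem norm_inc_congr (t : ZigzagTree 𝕜 X) (k : ℕ) {ω ω' : ℕ → Bool} (h : ∀ i < k, ω i = ω' i) :
    ‖t.inc k ω‖ = ‖t.inc k ω'‖ := by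
  induction t generalizing k ω ω' with
  | leaf => rfl
  | node z e l r hl hr =>
    cases k with
    | zero => simp only [inc]; split_ifs <;> simp
    | succ k =>
      have h' : ∀ i < k, ω (i + 1) = ω' (i + 1) := fun i hi => h _ (by omega)
      simp only [inc, h 0 (by omega)]
      split_ifs
      · exact hl k h'
      · exact hr k h'

omit [NormedSpace 𝕜 X] in
theorem inc_update_not (t : ZigzagTree 𝕜 X) (k : ℕ) (ω : ℕ → Bool) :
    t.inc k (Function.update ω k (!ω k)) = -t.inc k ω := by
  induction t generalizing k ω with
  | leaf => simp [inc]
  | node z e l r hl hr =>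
    cases k with
    | zero => cases h : ω 0 <;> simp [inc, h]
    | succ k =>
      have h1 : (fun i => Function.update ω (k + 1) (!ω (k + 1)) (i + 1)) =
          Function.update (fun i => ω (i + 1)) k (!ω (k + 1)) := by
        ext i
        simp [Function.update_apply]
      have h2 : Function.update ω (k + 1) (!ω (k + 1)) 0 = ω 0 := by simp
      simp only [inc, h1, h2, hl k, hr k]
      split_ifs <;> rfl

end ZigzagTree

section CoinSpace

/-- Sequences of `N` coin tosses, in an arbitrary universe. -/
abbrev Coins (N : ℕ) : Type w := Fin N → ULift.{w} Bool

/-- A finite sequence of coin tosses, continued by `false`. -/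
def Coins.toSeq {N : ℕ} (ω : Coins.{w} N) (i : ℕ) : Bool :=
  if h : i < N then (ω ⟨i, h⟩).down else false

/-- The `σ`-algebra at time `k` consists of the sets that depend on the first `k` tosses only. -/
def coinFiltration (N : ℕ) : Filtration ℕ (⊤ : MeasurableSpace (Coins.{w} N)) where
  seq k :=
    { MeasurableSet' := fun A => ∀ ω ω' : Coins N, (∀ i : Fin N, (i : ℕ) < k → ω i = ω' i) →
        (ω ∈ A ↔ ω' ∈ A)
      measurableSet_empty := fun _ _ _ => Iff.rfl
      measurableSet_compl := fun _ hA ω ω' h => not_congr (hA ω ω' h)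
      measurableSet_iUnion := fun _ hf ω ω' h => by
        simp only [Set.mem_iUnion]
        exact exists_congr fun i => hf i ω ω' h }
  mono' _ _ hij _ hA := fun ω ω' h => hA ω ω' fun i hi => h i (hi.trans_le hij)
  le' _ _ _ := trivial

theorem stronglyMeasurable_coinFiltration {N k : ℕ} {Y : Type*} [TopologicalSpace Y]
    [TopologicalSpace.PseudoMetrizableSpace Y] {f : Coins.{w} N → Y}
    (hf : ∀ ω ω' : Coins N, (∀ i : Fin N, (i : ℕ) < k → ω i = ω' i) → f ω = f ω') :
    StronglyMeasurable[coinFiltration N k] f := by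
  borelize Y
  let : MeasurableSpace (Coins.{w} N) := coinFiltration N k
  refine stronglyMeasurable_iff_measurable_separable.2
    ⟨fun s _ ω ω' h => ?_, (Set.finite_range f).countable.isSeparable⟩
  rw [Set.mem_preimage, Set.mem_preimage, hf ω ω' h]

/-- Fair coins. -/
noncomputable def coinMeasure (N : ℕ) : @Measure (Coins.{w} N) ⊤ :=
  letI : MeasurableSpace (Coins.{w} N) := ⊤
  (PMF.uniformOfFintype (Coins.{w} N)).toMeasure

instance (N : ℕ) : @IsProbabilityMeasure (Coins.{w} N) ⊤ (coinMeasure N) :=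
  letI : MeasurableSpace (Coins.{w} N) := ⊤
  PMF.toMeasure.isProbabilityMeasure _

theorem integral_coinMeasure {N : ℕ} {Y : Type*} [NormedAddCommGroup Y] [NormedSpace ℝ Y]
    [CompleteSpace Y] (f : Coins.{w} N → Y) :
    @integral _ _ _ _ ⊤ (coinMeasure N) f = ((2 : ℝ) ^ N)⁻¹ • ∑ ω, f ω := by
  let : MeasurableSpace (Coins.{w} N) := ⊤
  rw [coinMeasure, PMF.integral_eq_sum, Finset.smul_sum]
  refine Finset.sum_congr rfl fun ω _ => ?_
  simp [PMF.uniformOfFintype_apply]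

/-- The toss at time `k` reversed. -/
def flipCoin {N : ℕ} (k : ℕ) (ω : Coins.{w} N) : Coins.{w} N :=
  fun i => if (i : ℕ) = k then ⟨!(ω i).down⟩ else ω i

theorem flipCoin_involutive {N : ℕ} (k : ℕ) : Function.Involutive (flipCoin.{w} (N := N) k) := by
  intro ω
  ext i
  by_cases h : (i : ℕ) = k <;> simp [flipCoin, h]

theorem toSeq_flipCoin {N k : ℕ} (hk : k < N) (ω : Coins.{w} N) :
    (flipCoin k ω).toSeq = Function.update ω.toSeq k (!ω.toSeq k) := by
  ext i
  rcases eq_or_ne i k with rfl | hik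
  · simp [Coins.toSeq, flipCoin, hk]
  · simp [Coins.toSeq, flipCoin, hik]

theorem toSeq_cons_zero {N : ℕ} (b : ULift.{w} Bool) (ω : Coins.{w} N) :
    Coins.toSeq (N := N + 1) (Fin.cons b ω) 0 = b.down := by
  simp [Coins.toSeq]

theorem toSeq_cons_succ {N : ℕ} (b : ULift.{w} Bool) (ω : Coins.{w} N) (i : ℕ) :
    Coins.toSeq (N := N + 1) (Fin.cons b ω) (i + 1) = ω.toSeq i := by
  by_cases h : i < N
  · have : (⟨i + 1, Nat.succ_lt_succ h⟩ : Fin (N + 1)) = Fin.succ ⟨i, h⟩ := rfl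
    simp only [Coins.toSeq, h, Nat.succ_lt_succ h, dif_pos, this, Fin.cons_succ]
  · simp [Coins.toSeq, h]

theorem sum_coins_succ {N : ℕ} (G : Coins.{w} (N + 1) → ℝ) :
    ∑ ω, G ω = ∑ ω : Coins.{w} N, G (Fin.cons ⟨true⟩ ω) +
      ∑ ω : Coins.{w} N, G (Fin.cons ⟨false⟩ ω) := by
  rw [← (Fin.consEquiv fun _ : Fin (N + 1) => ULift.{w} Bool).sum_comp, Fintype.sum_prod_type,
    ← Equiv.ulift.symm.sum_comp, Fintype.sum_bool]
  rfl

variable {𝕜 : Type u} [RCLike 𝕜] {X : Type v} [NormedAddCommGroup X] [NormedSpace 𝕜 X]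

namespace ZigzagTree

/-- A strategy whose multipliers depend on the time only is a transform, on the coin space, of the
martingale with the differences `t.inc k`. -/
theorem sum_coins_eq_val (F : X → X → ℝ) (t : ZigzagTree 𝕜 X) {ε : ℕ → Metric.sphere (0 : 𝕜) 1}
    (ht : t.IsUniform ε) {N : ℕ} (hN : t.depth ≤ N) (x y : X) :
    ∑ ω : Coins.{w} N, F (x + ∑ k ∈ Finset.range N, t.inc k ω.toSeq)
      (y + ∑ k ∈ Finset.range N, (ε k : 𝕜) • t.inc k ω.toSeq) = 2 ^ N * t.val F x y := by
  induction t generalizing ε N x y with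
  | leaf => simp [inc, val]
  | node z e l r hl hr =>
    obtain ⟨N, rfl⟩ : ∃ M, N = M + 1 := ⟨N - 1, by simp only [depth] at hN; omega⟩
    simp only [depth, Nat.add_le_add_iff_right, max_le_iff] at hN
    have key : ∀ (b : Bool) (ω : Coins.{w} N),
        (fun i => Coins.toSeq (N := N + 1) (Fin.cons ⟨b⟩ ω) (i + 1)) = ω.toSeq :=
      fun b ω => funext fun i => toSeq_cons_succ _ _ _
    have h1 := hl ht.2.1 hN.1 (x + z) (y + (e : 𝕜) • z)
    have h2 := hr ht.2.2 hN.2 (x - z) (y - (e : 𝕜) • z)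
    have h3 : ε 0 = e := ht.1
    rw [sum_coins_succ]
    simp only [Finset.sum_range_succ', inc, toSeq_cons_zero, key, h3, if_true,
      Bool.false_eq_true, if_false, smul_neg]
    have h4 : ∀ a b c : X, a + (b + c) = a + c + b := fun a b c => by abel
    simp only [h4]
    simp only [← sub_eq_add_neg]
    rw [h1, h2, val]
    ring

end ZigzagTree

end CoinSpace

section CondExp

variable {Ω X : Type*} [NormedAddCommGroup X] [NormedSpace ℝ X] [CompleteSpace X]
  {m' m : MeasurableSpace Ω} {μ : Measure Ω} [IsFiniteMeasure μ] {f : Ω → X}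

theorem condExp_ae_eq_zero (hm : m' ≤ m) (hf : Integrable f μ)
    (h : ∀ A, MeasurableSet[m'] A → ∫ ω in A, f ω ∂μ = 0) : μ[f | m'] =ᵐ[μ] 0 := by
  refine (ae_eq_condExp_of_forall_setIntegral_eq hm hf (fun _ _ _ => integrableOn_zero) ?_
    aestronglyMeasurable_zero).symm
  intro A hA _
  simpa using (h A hA).symm

theorem setIntegral_eq_zero_of_condExp (hm : m' ≤ m) (hf : Integrable f μ)
    (h : μ[f | m'] =ᵐ[μ] 0) {A : Set Ω} (hA : MeasurableSet[m'] A) : ∫ ω in A, f ω ∂μ = 0 := by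
  rw [← setIntegral_condExp hm hf hA, integral_congr_ae (ae_restrict_of_ae h)]
  simp

end CondExp

section Predictable

variable (𝕜 : Type u) [RCLike 𝕜] (X : Type v) [NormedAddCommGroup X] [NormedSpace 𝕜 X]
  [NormedSpace ℝ X] [CompleteSpace X]

/-- The `L^p` estimate with constant `β` for bounded martingale difference sequences whose norms are
predictable. -/
def PredictableUMDBound (p β : ℝ) : Prop :=
  ∀ (Ω : Type w) (m : MeasurableSpace Ω) (μ : Measure Ω) (_ : IsProbabilityMeasure μ)
    (ℱ : Filtration ℕ m) (d : ℕ → Ω → X), IsMartingaleDiff d ℱ μ →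
    (∃ C : ℝ, ∀ n ω, ‖d n ω‖ ≤ C) → (∀ n, StronglyMeasurable[ℱ n] fun ω => ‖d (n + 1) ω‖) →
    ∀ ε : ℕ → 𝕜, (∀ j, ‖ε j‖ = 1) → ∀ n : ℕ,
      ∫⁻ ω, ‖∑ j ∈ Finset.range n, ε j • d (j + 1) ω‖ₑ ^ p ∂μ ≤
        ENNReal.ofReal β ^ p * ∫⁻ ω, ‖∑ j ∈ Finset.range n, d (j + 1) ω‖ₑ ^ p ∂μ

variable {𝕜 X} {p β : ℝ}

theorem PredictableUMDBound.zigzagBound (hp : 0 < p) (hβ : 0 ≤ β)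
    (h : PredictableUMDBound.{u, v, w} 𝕜 X p β) : ZigzagBound 𝕜 X p β := by
  intro t
  obtain ⟨t, ε, ht, hval⟩ := t.exists_isUniform
  rw [← hval]
  set N := t.depth with hN
  let : MeasurableSpace (Coins.{w} N) := ⊤
  let d : ℕ → Coins.{w} N → X := fun n ω => Nat.casesOn n 0 fun k =>
    if k < N then t.inc k ω.toSeq else 0
  have hint : ∀ {Y : Type v} [NormedAddCommGroup Y] (f : Coins.{w} N → Y),
      Integrable f (coinMeasure N) := fun f => Integrable.of_finite
  have hseq : ∀ k (ω ω' : Coins.{w} N), (∀ i : Fin N, (i : ℕ) < k → ω i = ω' i) →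
      ∀ i < k, ω.toSeq i = ω'.toSeq i := fun k ω ω' h i hi => by
    by_cases hiN : i < N
    · simp [Coins.toSeq, hiN, h ⟨i, hiN⟩ hi]
    · simp [Coins.toSeq, hiN]
  have hd : IsMartingaleDiff d (coinFiltration N) (coinMeasure N) := by
    refine ⟨fun n => ?_, fun n => hint _, fun n => ?_⟩
    · cases n with
      | zero => exact stronglyMeasurable_const
      | succ k =>
        refine stronglyMeasurable_coinFiltration fun ω ω' h => ?_
        simp only [d]
        split_ifs
        · exact t.inc_congr k fun i hi => hseq (k + 1) ω ω' h i (Nat.lt_succ_of_le hi)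
        · rfl
    · refine condExp_ae_eq_zero ((coinFiltration N).le n) (hint _) fun A hA => ?_
      rw [← integral_indicator ((coinFiltration N).le n A hA), integral_coinMeasure]
      by_cases hn : n < N
      · have hflip : ∀ ω : Coins.{w} N, A.indicator (d (n + 1)) (flipCoin n ω) =
            -A.indicator (d (n + 1)) ω := fun ω => by
          have h1 : flipCoin n ω ∈ A ↔ ω ∈ A := hA _ _ fun i hi => by
            simp [flipCoin, hi.ne]
          have h2 : d (n + 1) (flipCoin n ω) = -d (n + 1) ω := by
            simp only [d, hn, if_true, toSeq_flipCoin hn, t.inc_update_not]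
          by_cases hω : ω ∈ A
          · rw [Set.indicator_of_mem hω, Set.indicator_of_mem (h1.2 hω), h2]
          · rw [Set.indicator_of_notMem hω, Set.indicator_of_notMem (fun h => hω (h1.1 h)),
              neg_zero]
        have h3 := Equiv.sum_comp (flipCoin_involutive.{w} (N := N) n).toPerm
          (A.indicator (d (n + 1)))
        simp only [Function.Involutive.coe_toPerm, hflip, Finset.sum_neg_distrib] at h3
        have h4 : (2 : ℝ) • ∑ ω, A.indicator (d (n + 1)) ω = 0 := by
          rw [two_smul]
          exact eq_neg_iff_add_eq_zero.1 h3.symm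
        rw [(smul_eq_zero.1 h4).resolve_left two_ne_zero, smul_zero]
      · have : d (n + 1) = 0 := by
          funext ω
          simp [d, hn]
        simp [this]
  have key := h (Coins.{w} N) ⊤ (coinMeasure N) inferInstance (coinFiltration N) d hd ?_ ?_
    (fun k => ε k) (fun j => by simp) N
  · have hsum : ∀ ω : Coins.{w} N, ∀ c : ℕ → 𝕜, ∑ j ∈ Finset.range N, c j • d (j + 1) ω =
        ∑ j ∈ Finset.range N, c j • t.inc j ω.toSeq := fun ω c =>
      Finset.sum_congr rfl fun j hj => by simp [d, Finset.mem_range.1 hj]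
    have hsum1 : ∀ ω : Coins.{w} N, ∑ j ∈ Finset.range N, d (j + 1) ω =
        ∑ j ∈ Finset.range N, t.inc j ω.toSeq := fun ω => by simpa using hsum ω fun _ => 1
    simp only [hsum, hsum1] at key
    have hreal : ∀ f : Coins.{w} N → X, ∫⁻ ω, ‖f ω‖ₑ ^ p ∂coinMeasure N =
        ENNReal.ofReal (∫ ω, ‖f ω‖ ^ p ∂coinMeasure N) := fun f => by
      rw [ofReal_integral_eq_lintegral_ofReal Integrable.of_finite
        (ae_of_all _ fun ω => by positivity)]
      simp only [ofReal_norm_rpow hp.le]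
    rw [hreal, hreal, ENNReal.ofReal_rpow_of_nonneg hβ hp.le,
      ← ENNReal.ofReal_mul (by positivity), ENNReal.ofReal_le_ofReal_iff (by positivity)] at key
    have h4 := t.sum_coins_eq_val (powerPayoff p β) ht hN.ge 0 0
    simp only [zero_add] at h4
    rw [integral_coinMeasure, integral_coinMeasure, smul_eq_mul, smul_eq_mul] at key
    have h5 : (0 : ℝ) < 2 ^ N := by positivity
    have h6 : (2 : ℝ) ^ N * t.val (powerPayoff p β) 0 0 ≤ 0 := by
      rw [← h4]
      simp only [powerPayoff, Finset.sum_sub_distrib, ← Finset.mul_sum]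
      rw [mul_left_comm] at key
      have := le_of_mul_le_mul_left key (inv_pos.2 h5)
      linarith
    exact nonpos_of_mul_nonpos_right h6 h5
  · obtain ⟨C, hC⟩ := (Set.finite_range fun q : Fin (N + 1) × Coins.{w} N =>
      ‖d q.1 q.2‖).bddAbove
    refine ⟨max C 0, fun n ω => ?_⟩
    by_cases hn : n < N + 1
    · exact (hC ⟨(⟨n, hn⟩, ω), rfl⟩).trans (le_max_left _ _)
    · obtain ⟨k, rfl⟩ : ∃ k, n = k + 1 := ⟨n - 1, by omega⟩
      have : ¬ k < N := by omega
      simp [d, this]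
  · intro n
    refine stronglyMeasurable_coinFiltration fun ω ω' h => ?_
    simp only [d]
    split_ifs
    · exact t.norm_inc_congr n (hseq n ω ω' h)
    · rfl

omit [NormedSpace ℝ X] [CompleteSpace X] [NormedSpace 𝕜 X] in
theorem eLpNorm_le_ofReal_mul_iff (hp : 0 < p) {Ω : Type*} {m : MeasurableSpace Ω} {μ : Measure Ω}
    {f g : Ω → X} :
    eLpNorm g (ENNReal.ofReal p) μ ≤ ENNReal.ofReal β * eLpNorm f (ENNReal.ofReal p) μ ↔
      ∫⁻ ω, ‖g ω‖ₑ ^ p ∂μ ≤ ENNReal.ofReal β ^ p * ∫⁻ ω, ‖f ω‖ₑ ^ p ∂μ := by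
  have hp' : ENNReal.ofReal p ≠ 0 := by simpa using hp
  rw [eLpNorm_eq_lintegral_rpow_enorm_toReal hp' ENNReal.ofReal_ne_top,
    eLpNorm_eq_lintegral_rpow_enorm_toReal hp' ENNReal.ofReal_ne_top,
    ENNReal.toReal_ofReal hp.le, ← ENNReal.rpow_le_rpow_iff hp,
    ENNReal.mul_rpow_of_nonneg _ _ hp.le, ← ENNReal.rpow_mul, ← ENNReal.rpow_mul,
    one_div, inv_mul_cancel₀ hp.ne', ENNReal.rpow_one, ENNReal.rpow_one]

theorem UMDBound.predictable (hp : 0 < p) (h : UMDBound.{u, v, w} 𝕜 X p β) :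
    PredictableUMDBound.{u, v, w} 𝕜 X p β := by
  intro Ω m μ _ ℱ d hd ⟨C, hC⟩ _ ε hε n
  rcases Nat.eq_zero_or_pos n with rfl | hn
  · simp [hp]
  have hmem : ∀ j, MemLp (d j) (ENNReal.ofReal p) μ := fun j =>
    MemLp.of_bound (hd.integrable j).aestronglyMeasurable C (ae_of_all _ (hC j))
  have key := h Ω m μ inferInstance ℱ d hd hmem (fun j => ε (j - 1)) (fun j => hε _) n hn
  have hsum : ∀ f : ℕ → X, ∑ j ∈ Finset.Icc 1 n, f j = ∑ j ∈ Finset.range n, f (j + 1) :=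
    fun f => by
      rw [Finset.range_eq_Ico, Finset.sum_Ico_add' f 0 n 1]
      rfl
  simp only [hsum, Nat.add_sub_cancel] at key
  exact (eLpNorm_le_ofReal_mul_iff hp).1 key

end Predictable

/-! ### Running maxima, stopping, and Doob's inequality -/

section RunMax

variable {X : Type*} [NormedAddCommGroup X]

/-- The running maximum of the norms, `max (‖x 0‖, …, ‖x n‖)`. -/
def runMax (x : ℕ → X) : ℕ → ℝ
  | 0 => ‖x 0‖
  | n + 1 => max (runMax x n) ‖x (n + 1)‖

theorem runMax_le_iff {x : ℕ → X} {n : ℕ} {c : ℝ} : runMax x n ≤ c ↔ ∀ j ≤ n, ‖x j‖ ≤ c := by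
  induction n with
  | zero => simp [runMax]
  | succ n ih =>
    rw [runMax, max_le_iff, ih]
    constructor
    · rintro ⟨h1, h2⟩ j hj
      rcases Nat.le_succ_iff.1 hj with hj | rfl
      · exact h1 j hj
      · exact h2
    · exact fun h => ⟨fun j hj => h j (by omega), h _ le_rfl⟩

theorem norm_le_runMax (x : ℕ → X) {j n : ℕ} (h : j ≤ n) : ‖x j‖ ≤ runMax x n :=
  runMax_le_iff.1 le_rfl j h

theorem runMax_nonneg (x : ℕ → X) (n : ℕ) : 0 ≤ runMax x n :=
  (norm_nonneg _).trans (norm_le_runMax x (Nat.zero_le n))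

theorem runMax_mono (x : ℕ → X) : Monotone (runMax x) :=
  monotone_nat_of_le_succ fun _ => le_max_left _ _

theorem stronglyMeasurable_runMax {Ω : Type*} {m : MeasurableSpace Ω} {x : ℕ → Ω → X} {n : ℕ}
    (h : ∀ j ≤ n, StronglyMeasurable fun ω => ‖x j ω‖) :
    StronglyMeasurable fun ω => runMax (fun j => x j ω) n := by
  induction n with
  | zero => exact h 0 le_rfl
  | succ n ih => exact (ih fun j hj => h j (by omega)).sup (h _ le_rfl)

/-- The steps `j` of a pair of paths `x`, `y` taken after `y` has left the ball of radius `r` and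
before `y` leaves the ball of radius `2 r`, `x` leaves the ball of radius `a`, or a step of size
larger than `2 a` comes up. -/
def IsActive (x y : ℕ → X) (a r : ℝ) (j : ℕ) : Prop :=
  r < runMax y j ∧ runMax y j ≤ 2 * r ∧ runMax x j ≤ a ∧
    runMax (fun i => x (i + 1) - x i) j ≤ 2 * a

open Classical in
/-- The active steps form an interval of times at which `x` is small. -/
theorem norm_sum_active_le {x y : ℕ → X} {a r : ℝ} (ha : 0 ≤ a) (n : ℕ) :
    ‖∑ j ∈ Finset.range n, if IsActive x y a r j then x (j + 1) - x j else 0‖ ≤ 4 * a := by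
  set A : ℕ → X := fun n => ∑ j ∈ Finset.range n, if IsActive x y a r j then x (j + 1) - x j else 0
    with hA
  have hsucc : ∀ n, A (n + 1) = A n + if IsActive x y a r n then x (n + 1) - x n else 0 :=
    fun n => Finset.sum_range_succ _ _
  have hx : ∀ n, IsActive x y a r n → ‖x n‖ ≤ a ∧ ‖x (n + 1)‖ ≤ 3 * a := fun n h => by
    have h1 := (norm_le_runMax x le_rfl).trans h.2.2.1
    have h2 := (norm_le_runMax (fun i => x (i + 1) - x i) le_rfl).trans h.2.2.2
    refine ⟨h1, ?_⟩
    have := norm_add_le (x (n + 1) - x n) (x n)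
    rw [sub_add_cancel] at this
    linarith
  let c : ℕ → Prop := fun j => runMax y j ≤ 2 * r ∧ runMax x j ≤ a ∧
    runMax (fun i => x (i + 1) - x i) j ≤ 2 * a
  have hc : ∀ n, ¬c n → ¬c (n + 1) := fun n h h' =>
    h ⟨(runMax_mono _ n.le_succ).trans h'.1, (runMax_mono _ n.le_succ).trans h'.2.1,
      (runMax_mono _ n.le_succ).trans h'.2.2⟩
  -- not yet started, running since time `m`, or stopped
  have key : ∀ n, A n = 0 ∨
      (r < runMax y n ∧ ‖x n‖ ≤ 3 * a ∧ ∃ m, ‖x m‖ ≤ a ∧ A n = x n - x m) ∨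
      (¬c n ∧ ‖A n‖ ≤ 4 * a) := by
    intro n
    induction n with
    | zero => exact Or.inl (by simp [hA])
    | succ n ih =>
      by_cases hn : IsActive x y a r n
      · have hb : r < runMax y (n + 1) := hn.1.trans_le (runMax_mono _ n.le_succ)
        have hs : A (n + 1) = A n + (x (n + 1) - x n) := by rw [hsucc, if_pos hn]
        rcases ih with ih | ⟨-, -, m, hm, ih⟩ | ⟨ih, -⟩
        · exact Or.inr (Or.inl ⟨hb, (hx n hn).2, n, (hx n hn).1, by rw [hs, ih, zero_add]⟩)
        · exact Or.inr (Or.inl ⟨hb, (hx n hn).2, m, hm, by rw [hs, ih]; abel⟩)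
        · exact absurd hn.2 ih
      · have hs : A (n + 1) = A n := by rw [hsucc, if_neg hn, add_zero]
        rw [hs]
        rcases ih with ih | ⟨hb, hxn, m, hm, ih⟩ | ⟨h1, h2⟩
        · exact Or.inl ih
        · refine Or.inr (Or.inr ⟨hc n fun h => hn ⟨hb, h⟩, ?_⟩)
          rw [ih]
          exact (norm_sub_le _ _).trans (by linarith)
        · exact Or.inr (Or.inr ⟨hc n h1, h2⟩)
  rcases key n with h | ⟨-, hxn, m, hm, h⟩ | ⟨-, h⟩
  · change ‖A n‖ ≤ _
    rw [h, norm_zero]; linarith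
  · change ‖A n‖ ≤ _
    rw [h]
    exact (norm_sub_le _ _).trans (by linarith)
  · exact h

open Classical in
theorem sum_active_eq_zero {x y : ℕ → X} {a r : ℝ} {n : ℕ} (h : runMax y n ≤ r) (d : ℕ → X) :
    (∑ j ∈ Finset.range n, if IsActive x y a r j then d j else 0) = 0 :=
  Finset.sum_eq_zero fun _ hj => if_neg fun hA =>
    (hA.1.trans_le ((runMax_mono y (Finset.mem_range.1 hj).le).trans h)).false

open Classical in
/-- If `x` stays small while `y` comes to size `2 r`, the active steps carry `y` from the sphere of
radius `r`, up to one small step, to the sphere of radius `2 r`. -/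
theorem le_norm_sum_active {x y : ℕ → X} {a r : ℝ} (hr : 0 < r) (har : 4 * a ≤ r) {n : ℕ}
    (hy0 : y 0 = 0) (hxy : ∀ j, ‖y (j + 1) - y j‖ = ‖x (j + 1) - x j‖)
    (hyn : 2 * r < runMax y n) (hxn : runMax x n ≤ a) :
    r / 2 ≤ ‖∑ j ∈ Finset.range n, if IsActive x y a r j then y (j + 1) - y j else 0‖ := by
  have hstep : ∀ j < n, ‖x (j + 1) - x j‖ ≤ 2 * a := fun j hj => by
    have h1 := (norm_le_runMax x (j := j) hj.le).trans hxn
    have h2 := (norm_le_runMax x (j := j + 1) hj).trans hxn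
    exact (norm_sub_le _ _).trans (by linarith)
  have hex : ∀ c < runMax y n, ∃ k ≤ n, c < ‖y k‖ := fun c hc => by
    by_contra! h
    exact absurd (runMax_le_iff.2 h) (not_le.2 hc)
  have ex1 : ∃ k, r < runMax y k := ⟨n, by linarith⟩
  have ex2 : ∃ k, 2 * r < runMax y k := ⟨n, hyn⟩
  set m := Nat.find ex1 with hm
  set s := Nat.find ex2 with hs
  have hms : m ≤ s := Nat.find_min' ex1 (by linarith [Nat.find_spec ex2])
  have hsn : s ≤ n := Nat.find_min' ex2 hyn
  have hact : ∀ j ∈ Finset.range n, IsActive x y a r j ↔ j ∈ Finset.Ico m s := fun j hj => by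
    rw [Finset.mem_range] at hj
    rw [Finset.mem_Ico]
    constructor
    · intro h
      refine ⟨Nat.find_min' ex1 h.1, ?_⟩
      by_contra! hsj
      exact absurd ((Nat.find_spec ex2).trans_le (runMax_mono y hsj)) (not_lt.2 h.2.1)
    · rintro ⟨h1, h2⟩
      refine ⟨(Nat.find_spec ex1).trans_le (runMax_mono y h1), not_lt.1 (Nat.find_min ex2 h2),
        (runMax_mono x hj.le).trans hxn, runMax_le_iff.2 fun i hi => hstep i (by omega)⟩
  have hsum : (∑ j ∈ Finset.range n, if IsActive x y a r j then y (j + 1) - y j else 0) =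
      y s - y m := by
    rw [Finset.sum_congr rfl fun j hj => if_congr (hact j hj) rfl rfl, Finset.sum_ite_mem,
      Finset.inter_eq_right.2 (fun j hj =>
        Finset.mem_range.2 ((Finset.mem_Ico.1 hj).2.trans_le hsn)),
      Finset.sum_Ico_sub _ hms]
  have hfirst : ∀ (c : ℝ) (hc : 0 < c) (ex : ∃ k, c < runMax y k), ∃ i, Nat.find ex = i + 1 ∧
      runMax y i ≤ c ∧ c < ‖y (i + 1)‖ := fun c hc ex => by
    rcases h : Nat.find ex with _ | i
    · have := Nat.find_spec ex
      rw [h, runMax, hy0, norm_zero] at this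
      linarith
    · have h1 := Nat.find_spec ex
      have h2 : runMax y i ≤ c := not_lt.1 (Nat.find_min ex (by omega))
      rw [h, runMax, lt_max_iff] at h1
      exact ⟨i, rfl, h2, h1.resolve_left (not_lt.2 h2)⟩
  obtain ⟨i, hi, hi1, -⟩ := hfirst r hr ex1
  obtain ⟨k, hk, -, hk2⟩ := hfirst (2 * r) (by linarith) ex2
  have h1 : ‖y m‖ ≤ r + 2 * a := by
    rw [hm, hi]
    have h2 := norm_add_le (y (i + 1) - y i) (y i)
    rw [sub_add_cancel, hxy] at h2
    have h3 := hstep i (by omega)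
    have h4 := (norm_le_runMax y (le_refl i)).trans hi1
    linarith
  have h2 : 2 * r < ‖y s‖ := by rwa [hs, hk]
  rw [hsum]
  have := norm_sub_norm_le (y s) (y m)
  linarith

end RunMax

section Doob

variable {X : Type*} [NormedAddCommGroup X] [NormedSpace ℝ X] [CompleteSpace X] {Ω : Type*}
  {m' m : MeasurableSpace Ω} {μ : Measure Ω} [IsProbabilityMeasure μ]

/-- The submartingale inequality for the norm, tested against a nonnegative weight: the concave
function `(x, c) ↦ -‖x‖ |c|` of `x` has linear supports. -/
theorem integral_norm_mul_le (hm : m' ≤ m) {x d : Ω → X} {c : Ω → ℝ} (hx : StronglyMeasurable[m'] x)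
    (hc : StronglyMeasurable[m'] c) (hc0 : ∀ ω, 0 ≤ c ω) (hx2 : MemLp x 2 μ) (hc2 : MemLp c 2 μ)
    (hd2 : MemLp d 2 μ) (hd : ∀ A, MeasurableSet[m'] A → ∫ ω in A, d ω ∂μ = 0) :
    ∫ ω, ‖x ω‖ * c ω ∂μ ≤ ∫ ω, ‖x ω + d ω‖ * c ω ∂μ := by
  have h2 : (2 : ℝ≥0∞) = ENNReal.ofReal 2 := by simp
  have key := integral_comp_add_le (μ := μ) (U := fun q : X × ℝ => -(‖q.1‖ * |q.2|)) (C := 1)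
    (p := 2) (W := fun ω => (x ω, c ω)) (ξ := fun ω => (d ω, (0 : ℝ))) (by fun_prop) zero_le_one
    one_le_two ?_ hm (hx.prodMk hc) (h2 ▸ memLp_prod_iff.2 ⟨hx2, hc2⟩)
    (h2 ▸ memLp_prod_iff.2 ⟨hd2, MemLp.zero⟩) ?_ ?_
  · simp only [Prod.mk_add_mk, add_zero, integral_neg, abs_of_nonneg (hc0 _)] at key
    linarith
  · intro q
    rw [abs_neg, abs_of_nonneg (by positivity), one_mul, Real.rpow_two, sq]
    exact mul_le_mul (norm_fst_le q) (norm_snd_le q) (abs_nonneg _) (norm_nonneg _)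
  · intro A hA
    rw [integral_pair (hd2.integrable one_le_two).integrableOn (integrable_zero _ _ _), hd A hA]
    simp
  · intro q
    obtain ⟨g, hg, hgq⟩ := exists_dual_vector'' ℝ q.1
    refine ⟨-(|q.2| • g.comp (ContinuousLinearMap.fst ℝ X ℝ)), ae_of_all _ fun ω => ?_⟩
    have h1 : g (q.1 + d ω) ≤ ‖q.1 + d ω‖ :=
      (le_abs_self _).trans ((g.le_opNorm _).trans (mul_le_of_le_one_left (norm_nonneg _) hg))
    rw [map_add, hgq] at h1
    simp only [RCLike.ofReal_real_eq_id, id] at h1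
    simp only [Prod.fst_add, Prod.snd_add, add_zero, neg_apply, smul_apply,
      ContinuousLinearMap.comp_apply, ContinuousLinearMap.coe_fst', smul_eq_mul]
    nlinarith [mul_le_mul_of_nonneg_right h1 (abs_nonneg q.2)]

/-- The pathwise inequality behind Doob's maximal inequality. -/
theorem rpow_max_sub_le {p : ℝ} (hp : 1 < p) {s t : ℝ} (hs : 0 ≤ s) (ht : 0 ≤ t) :
    max t s ^ p - p / (p - 1) * (s * max t s ^ (p - 1)) ≤
      t ^ p - p / (p - 1) * (s * t ^ (p - 1)) := by
  rcases le_total s t with h | h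
  · rw [max_eq_left h]
  rw [max_eq_right h]
  have hp1 : 0 < p - 1 := by linarith
  have hpq : p.HolderConjugate (p / (p - 1)) := Real.HolderConjugate.conjExponent hp
  have hy := Real.young_inequality_of_nonneg hs (Real.rpow_nonneg ht (p - 1)) hpq
  rw [← Real.rpow_mul ht, mul_div_cancel₀ _ hp1.ne'] at hy
  have hsp : s * s ^ (p - 1) = s ^ p := by
    rcases hs.eq_or_lt with rfl | hs'
    · rw [zero_mul, Real.zero_rpow (by linarith)]
    · rw [← Real.rpow_one_add' hs (by linarith)]; congr 1; ring
  rw [hsp]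
  have h1 := mul_le_mul_of_nonneg_left hy (by positivity : 0 ≤ p / (p - 1))
  have h2 : p / (p - 1) * (s ^ p / p + t ^ p / (p / (p - 1))) =
      (p / (p - 1) - 1) * s ^ p + t ^ p := by
    field_simp
    ring
  rw [h2] at h1
  linarith

theorem const_mul_rpow_le {p K : ℝ} (hp : 1 < p) (hK : 0 ≤ K) {s t : ℝ} (hs : 0 ≤ s)
    (ht : 0 ≤ t) : K * (s * t ^ (p - 1)) ≤ t ^ p / 2 + (2 * K) ^ p * s ^ p := by
  have hpow : ∀ t : ℝ, 0 ≤ t → t * t ^ (p - 1) = t ^ p := fun t ht => by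
    rw [← Real.rpow_one_add' ht (by linarith)]; congr 1; ring
  have h0 : 0 ≤ t ^ p := by positivity
  have h1 : 0 ≤ (2 * K) ^ p * s ^ p := by positivity
  rcases le_total (K * s) (t / 2) with h | h
  · have := mul_le_mul_of_nonneg_right h (Real.rpow_nonneg ht (p - 1))
    rw [div_mul_eq_mul_div, hpow t ht] at this
    linarith
  · have hts : t ≤ 2 * K * s := by linarith
    have h3 : t ^ (p - 1) ≤ (2 * K * s) ^ (p - 1) := Real.rpow_le_rpow ht hts (by linarith)
    have h4 := mul_le_mul_of_nonneg_left h3 (by positivity : 0 ≤ 2 * K * s)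
    rw [hpow _ (by positivity), Real.mul_rpow (by positivity) hs] at h4
    have h5 : 0 ≤ 2 * K * s * t ^ (p - 1) := by positivity
    nlinarith

/-- Doob's maximal inequality for bounded martingales that start at the origin. -/
theorem integral_runMax_rpow_le {ℱ : Filtration ℕ m} {d : ℕ → Ω → X} (hd : IsMartingaleDiff d ℱ μ)
    {C : ℝ} (hC : ∀ n ω, ‖d n ω‖ ≤ C) {p : ℝ} (hp : 1 < p) (n : ℕ) :
    ∫ ω, runMax (fun k => ∑ j ∈ Finset.range k, d (j + 1) ω) n ^ p ∂μ ≤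
      2 * (2 * (p / (p - 1))) ^ p * ∫ ω, ‖∑ j ∈ Finset.range n, d (j + 1) ω‖ ^ p ∂μ := by
  set x : ℕ → Ω → X := fun k ω => ∑ j ∈ Finset.range k, d (j + 1) ω with hx
  set M : ℕ → Ω → ℝ := fun k ω => runMax (fun k => x k ω) k with hM
  have hp1 : 0 < p - 1 := by linarith
  have hC0 : 0 ≤ C := by
    obtain ⟨ω⟩ := nonempty_of_isProbabilityMeasure μ
    exact (norm_nonneg _).trans (hC 0 ω)
  have hxm : ∀ k, StronglyMeasurable[ℱ k] (x k) := fun k =>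
    Finset.stronglyMeasurable_fun_sum _ fun j hj =>
      (hd.adapted (j + 1)).mono (ℱ.mono (Finset.mem_range.1 hj))
  have hMm : ∀ k, StronglyMeasurable[ℱ k] (M k) := fun k =>
    stronglyMeasurable_runMax fun j hj => ((hxm j).mono (ℱ.mono hj)).norm
  have hxb : ∀ k ω, ‖x k ω‖ ≤ k * C := fun k ω => by
    refine (norm_sum_le_of_le _ fun j _ => hC (j + 1) ω).trans ?_
    simp
  have hM0 : ∀ k ω, 0 ≤ M k ω := fun k ω => runMax_nonneg _ _
  have hMb : ∀ k ω, M k ω ≤ k * C := fun k ω => runMax_le_iff.2 fun j hj =>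
    (hxb j ω).trans (by gcongr)
  have hint : ∀ {f : Ω → ℝ} (B : ℝ), AEStronglyMeasurable f μ → (∀ ω, ‖f ω‖ ≤ B) →
      Integrable f μ := fun B hf hB =>
    (MemLp.of_bound hf B (ae_of_all _ hB) (p := 1)).integrable le_rfl
  have hxs : ∀ k, StronglyMeasurable (x k) := fun k => (hxm k).mono (ℱ.le k)
  have hMs : ∀ k, StronglyMeasurable (M k) := fun k => (hMm k).mono (ℱ.le k)
  have hpow : ∀ k {q : ℝ}, 0 ≤ q → StronglyMeasurable fun ω => M k ω ^ q := fun k q hq =>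
    (Real.continuous_rpow_const hq).comp_stronglyMeasurable (hMs k)
  have hMi : ∀ k, Integrable (fun ω => M k ω ^ p) μ := fun k =>
    hint ((k * C) ^ p) (hpow k (by linarith)).aestronglyMeasurable fun ω => by
      rw [Real.norm_of_nonneg (Real.rpow_nonneg (hM0 k ω) _)]
      exact Real.rpow_le_rpow (hM0 k ω) (hMb k ω) (by linarith)
  have hxMi : ∀ l k, Integrable (fun ω => ‖x l ω‖ * M k ω ^ (p - 1)) μ := fun l k =>
    hint ((l * C) * (k * C) ^ (p - 1))
      ((hxs l).norm.mul (hpow k hp1.le)).aestronglyMeasurable fun ω => by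
        rw [norm_mul, norm_norm, Real.norm_of_nonneg (Real.rpow_nonneg (hM0 k ω) _)]
        exact mul_le_mul (hxb l ω) (Real.rpow_le_rpow (hM0 k ω) (hMb k ω) hp1.le)
          (Real.rpow_nonneg (hM0 k ω) _) (by positivity)
  have hSi : Integrable (fun ω => ‖x n ω‖ ^ p) μ :=
    hint ((n * C) ^ p) ((Real.continuous_rpow_const (by linarith)).comp_stronglyMeasurable
      (hxs n).norm).aestronglyMeasurable fun ω => by
        rw [Real.norm_of_nonneg (by positivity)]
        exact Real.rpow_le_rpow (norm_nonneg _) (hxb n ω) (by linarith)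
  have key : ∀ k, ∫ ω, M k ω ^ p ∂μ - p / (p - 1) * ∫ ω, ‖x k ω‖ * M k ω ^ (p - 1) ∂μ ≤ 0 := by
    intro k
    induction k with
    | zero => simp [hM, hx, runMax, Real.zero_rpow (by linarith : p ≠ 0)]
    | succ k ih =>
      refine le_trans ?_ ih
      have h1 : ∫ ω, ‖x k ω‖ * M k ω ^ (p - 1) ∂μ ≤ ∫ ω, ‖x (k + 1) ω‖ * M k ω ^ (p - 1) ∂μ := by
        have hxk : ∀ ω, x (k + 1) ω = x k ω + d (k + 1) ω := fun ω => Finset.sum_range_succ _ _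
        simp only [hxk]
        refine integral_norm_mul_le (ℱ.le k) (hxm k)
          ((Real.continuous_rpow_const hp1.le).comp_stronglyMeasurable (hMm k))
          (fun ω => Real.rpow_nonneg (hM0 k ω) _)
          (MemLp.of_bound (hxs k).aestronglyMeasurable (k * C) (ae_of_all _ (hxb k)))
          (MemLp.of_bound (hpow k hp1.le).aestronglyMeasurable ((k * C) ^ (p - 1))
            (ae_of_all _ fun ω => ?_))
          (MemLp.of_bound (hd.integrable _).aestronglyMeasurable C (ae_of_all _ (hC _)))
          fun A hA => setIntegral_eq_zero_of_condExp (ℱ.le k) (hd.integrable _)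
            (hd.condExp_succ k) hA
        rw [Real.norm_of_nonneg (Real.rpow_nonneg (hM0 k ω) _)]
        exact Real.rpow_le_rpow (hM0 k ω) (hMb k ω) hp1.le
      have h2 : ∫ ω, (M (k + 1) ω ^ p - p / (p - 1) * (‖x (k + 1) ω‖ * M (k + 1) ω ^ (p - 1))) ∂μ ≤
          ∫ ω, (M k ω ^ p - p / (p - 1) * (‖x (k + 1) ω‖ * M k ω ^ (p - 1))) ∂μ :=
        integral_mono ((hMi _).sub ((hxMi _ _).const_mul _)) ((hMi _).sub ((hxMi _ _).const_mul _))
          fun ω => rpow_max_sub_le hp (norm_nonneg _) (hM0 k ω)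
      rw [integral_sub (hMi _) ((hxMi _ _).const_mul _),
        integral_sub (hMi _) ((hxMi _ _).const_mul _), integral_const_mul, integral_const_mul] at h2
      have h3 := mul_le_mul_of_nonneg_left h1 (by positivity : 0 ≤ p / (p - 1))
      linarith
  have hlast : p / (p - 1) * ∫ ω, ‖x n ω‖ * M n ω ^ (p - 1) ∂μ ≤
      (∫ ω, M n ω ^ p ∂μ) / 2 + (2 * (p / (p - 1))) ^ p * ∫ ω, ‖x n ω‖ ^ p ∂μ := by
    rw [← integral_const_mul, ← integral_const_mul, ← integral_div,
      ← integral_add ((hMi n).div_const 2) (hSi.const_mul _)]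
    exact integral_mono ((hxMi n n).const_mul _) (((hMi n).div_const 2).add (hSi.const_mul _))
      fun ω => const_mul_rpow_le hp (by positivity) (norm_nonneg _) (hM0 n ω)
  linarith [key n]

end Doob

/-! ### Extrapolation by the good-`λ` method -/

section GoodLambda

variable {𝕜 : Type u} [RCLike 𝕜] {X : Type v} [NormedAddCommGroup X] [NormedSpace 𝕜 X]
  [NormedSpace ℝ X] [CompleteSpace X]

omit [NormedSpace ℝ X] [CompleteSpace X] in
theorem lintegral_enorm_rpow_eq {Ω : Type*} {m : MeasurableSpace Ω} {μ : Measure Ω} {p : ℝ}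
    (hp : 0 ≤ p) {f : Ω → X} (hf : Integrable (fun ω => ‖f ω‖ ^ p) μ) :
    ∫⁻ ω, ‖f ω‖ₑ ^ p ∂μ = ENNReal.ofReal (∫ ω, ‖f ω‖ ^ p ∂μ) := by
  rw [ofReal_integral_eq_lintegral_ofReal hf (ae_of_all _ fun ω => by positivity)]
  simp only [← ofReal_norm_rpow hp]

/-- Multiplying martingale differences by predictable indicators. -/
theorem IsMartingaleDiff.indicator {Ω : Type*} {m : MeasurableSpace Ω} {μ : Measure Ω}
    [IsFiniteMeasure μ] {ℱ : Filtration ℕ m} {d : ℕ → Ω → X} (hd : IsMartingaleDiff d ℱ μ)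
    {V : ℕ → Set Ω} (hV : ∀ n, MeasurableSet[ℱ n] (V n)) :
    IsMartingaleDiff (fun n => Nat.casesOn n 0 fun k => (V k).indicator (d (k + 1))) ℱ μ := by
  refine ⟨fun n => ?_, fun n => ?_, fun n => ?_⟩
  · cases n with
    | zero => exact stronglyMeasurable_zero
    | succ k => exact (hd.adapted (k + 1)).indicator (ℱ.mono k.le_succ _ (hV k))
  · cases n with
    | zero => exact integrable_zero _ _ _
    | succ k => exact (hd.integrable (k + 1)).indicator (ℱ.le k _ (hV k))
  · refine (condExp_indicator (hd.integrable (n + 1)) (hV n)).trans ?_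
    filter_upwards [hd.condExp_succ n] with ω hω
    by_cases hV : ω ∈ V n
    · rw [Set.indicator_of_mem hV, hω]
    · rw [Set.indicator_of_notMem hV]
      rfl

/-- The good-`λ` inequality: if the transform `y` has come to size `r` and `x` stays small, then `y`
is unlikely to come to size `2 r`. The transform of the active steps is estimated in `L^q`. -/
theorem PredictableUMDBound.good_lambda {q β : ℝ} (hq : 0 < q) (hβ : 0 ≤ β)
    (h : PredictableUMDBound.{u, v, w} 𝕜 X q β) {Ω : Type w} {m : MeasurableSpace Ω} {μ : Measure Ω}
    [IsProbabilityMeasure μ] {ℱ : Filtration ℕ m} {d : ℕ → Ω → X} (hd : IsMartingaleDiff d ℱ μ)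
    {C : ℝ} (hC : ∀ n ω, ‖d n ω‖ ≤ C) (hpred : ∀ n, StronglyMeasurable[ℱ n] fun ω => ‖d (n + 1) ω‖)
    {ε : ℕ → 𝕜} (hε : ∀ j, ‖ε j‖ = 1) (n : ℕ) {δ r : ℝ} (hδ : 0 < δ) (hδ' : 4 * δ ≤ 1)
    (hr : 0 < r) :
    μ {ω | 2 * r < runMax (fun k => ∑ j ∈ Finset.range k, ε j • d (j + 1) ω) n} ≤
      μ {ω | δ * r < runMax (fun k => ∑ j ∈ Finset.range k, d (j + 1) ω) n} +
      ENNReal.ofReal ((8 * β * δ) ^ q) *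
        μ {ω | r < runMax (fun k => ∑ j ∈ Finset.range k, ε j • d (j + 1) ω) n} := by
  classical
  set x : Ω → ℕ → X := fun ω k => ∑ j ∈ Finset.range k, d (j + 1) ω with hx
  set y : Ω → ℕ → X := fun ω k => ∑ j ∈ Finset.range k, ε j • d (j + 1) ω with hy
  have hxs : ∀ ω j, x ω (j + 1) - x ω j = d (j + 1) ω := fun ω j => by
    simp [hx, Finset.sum_range_succ]
  have hys : ∀ ω j, y ω (j + 1) - y ω j = ε j • d (j + 1) ω := fun ω j => by
    simp [hy, Finset.sum_range_succ]
  have hxm : ∀ k, StronglyMeasurable[ℱ k] fun ω => x ω k := fun k =>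
    Finset.stronglyMeasurable_fun_sum _ fun j hj =>
      (hd.adapted (j + 1)).mono (ℱ.mono (Finset.mem_range.1 hj))
  have hym : ∀ k, StronglyMeasurable[ℱ k] fun ω => y ω k := fun k =>
    Finset.stronglyMeasurable_fun_sum _ fun j hj =>
      ((hd.adapted (j + 1)).mono (ℱ.mono (Finset.mem_range.1 hj))).const_smul (ε j)
  have hXm : ∀ k, StronglyMeasurable[ℱ k] fun ω => runMax (x ω) k := fun k =>
    stronglyMeasurable_runMax (x := fun j ω => x ω j) fun j hj => ((hxm j).mono (ℱ.mono hj)).norm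
  have hYm : ∀ k, StronglyMeasurable[ℱ k] fun ω => runMax (y ω) k := fun k =>
    stronglyMeasurable_runMax (x := fun j ω => y ω j) fun j hj => ((hym j).mono (ℱ.mono hj)).norm
  have hDm : ∀ k, StronglyMeasurable[ℱ k] fun ω =>
      runMax (fun i => x ω (i + 1) - x ω i) k := fun k =>
    stronglyMeasurable_runMax (x := fun i ω => x ω (i + 1) - x ω i) fun j hj => by
      simp only [hxs]
      exact (hpred j).mono (ℱ.mono hj)
  set V : ℕ → Set Ω := fun k => {ω | IsActive (x ω) (y ω) (δ * r) r k} with hV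
  have hVm : ∀ k, MeasurableSet[ℱ k] (V k) := fun k => by
    have h1 := (hYm k).measurable
    have h2 := (hXm k).measurable
    have h3 := (hDm k).measurable
    exact (measurableSet_lt measurable_const h1).inter
      ((measurableSet_le h1 measurable_const).inter
        ((measurableSet_le h2 measurable_const).inter (measurableSet_le h3 measurable_const)))
  have key := h Ω m μ inferInstance ℱ _ (hd.indicator hVm) ⟨C, ?_⟩ ?_ ε hε n
  rotate_left
  · intro k ω
    cases k with
    | zero => simpa using (norm_nonneg _).trans (hC 0 ω)
    | succ k => exact (norm_indicator_le_norm_self _ _).trans (hC _ ω)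
  · intro k
    simp only [norm_indicator_eq_indicator_norm]
    exact (hpred k).indicator (hVm k)
  have hsum1 : ∀ ω, ∑ j ∈ Finset.range n, (V j).indicator (d (j + 1)) ω =
      ∑ j ∈ Finset.range n, if IsActive (x ω) (y ω) (δ * r) r j then x ω (j + 1) - x ω j else 0 :=
    fun ω => Finset.sum_congr rfl fun j _ => by rw [hxs]; rfl
  have hsum2 : ∀ ω, ∑ j ∈ Finset.range n, ε j • (V j).indicator (d (j + 1)) ω =
      ∑ j ∈ Finset.range n, if IsActive (x ω) (y ω) (δ * r) r j then y ω (j + 1) - y ω j else 0 :=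
    fun ω => Finset.sum_congr rfl fun j _ => by
      rw [hys, Set.indicator_apply, smul_ite, smul_zero]; rfl
  simp only [hsum1, hsum2] at key
  set A : Set Ω := {ω | r < runMax (y ω) n} with hA
  set B : Set Ω := {ω | 2 * r < runMax (y ω) n} with hB
  set D : Set Ω := {ω | δ * r < runMax (x ω) n} with hD
  have hAm : MeasurableSet A := measurableSet_lt measurable_const ((hYm n).mono (ℱ.le n)).measurable
  have hBm : MeasurableSet B := measurableSet_lt measurable_const ((hYm n).mono (ℱ.le n)).measurable
  have hDm' : MeasurableSet D :=
    measurableSet_lt measurable_const ((hXm n).mono (ℱ.le n)).measurable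
  have hup : ∫⁻ ω, ‖∑ j ∈ Finset.range n,
      if IsActive (x ω) (y ω) (δ * r) r j then x ω (j + 1) - x ω j else 0‖ₑ ^ q ∂μ ≤
      ENNReal.ofReal ((4 * (δ * r)) ^ q) * μ A := by
    rw [← lintegral_indicator_const hAm]
    refine lintegral_mono fun ω => ?_
    by_cases hω : ω ∈ A
    · rw [Set.indicator_of_mem hω, ← ofReal_norm_rpow hq.le]
      exact ENNReal.ofReal_le_ofReal (Real.rpow_le_rpow (norm_nonneg _)
        (norm_sum_active_le (by positivity) n) hq.le)
    · rw [sum_active_eq_zero (not_lt.1 hω)]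
      simp [hq]
  have hlow : ENNReal.ofReal ((r / 2) ^ q) * μ (B \ D) ≤ ∫⁻ ω, ‖∑ j ∈ Finset.range n,
      if IsActive (x ω) (y ω) (δ * r) r j then y ω (j + 1) - y ω j else 0‖ₑ ^ q ∂μ := by
    rw [← lintegral_indicator_const (hBm.diff hDm')]
    refine lintegral_mono fun ω => ?_
    by_cases hω : ω ∈ B \ D
    · rw [Set.indicator_of_mem hω, ← ofReal_norm_rpow hq.le]
      refine ENNReal.ofReal_le_ofReal (Real.rpow_le_rpow (by positivity) ?_ hq.le)
      refine le_norm_sum_active hr (by nlinarith) (by simp [hy]) (fun j => ?_) hω.1 (not_lt.1 hω.2)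
      rw [hys, hxs, norm_smul, hε, one_mul]
    · rw [Set.indicator_of_notMem hω]
      exact zero_le
  have hmain : μ (B \ D) ≤ ENNReal.ofReal ((8 * β * δ) ^ q) * μ A := by
    have h1 := (hlow.trans key).trans (mul_le_mul_right hup _)
    rw [← mul_assoc, ENNReal.ofReal_rpow_of_nonneg hβ hq.le, ← ENNReal.ofReal_mul (by positivity),
      ← Real.mul_rpow hβ (by positivity),
      show β * (4 * (δ * r)) = (r / 2) * (8 * β * δ) by ring,
      Real.mul_rpow (by positivity) (by positivity), ENNReal.ofReal_mul (by positivity),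
      mul_assoc] at h1
    exact (ENNReal.mul_le_mul_iff_right (by simpa using by positivity) ENNReal.ofReal_ne_top).1 h1
  calc μ B ≤ μ (D ∪ B \ D) := measure_mono (by
        rw [Set.union_sdiff_self]; exact Set.subset_union_right)
    _ ≤ μ D + μ (B \ D) := measure_union_le _ _
    _ ≤ _ := by gcongr

/-- Extrapolation: the estimate with one exponent gives the estimate with every exponent. -/
theorem PredictableUMDBound.exists_of_exponent {q β : ℝ} (hq : 0 < q) (hβ : 0 ≤ β)
    (h : PredictableUMDBound.{u, v, w} 𝕜 X q β) {p : ℝ} (hp : 1 < p) :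
    ∃ γ : ℝ, 0 < γ ∧ PredictableUMDBound.{u, v, w} 𝕜 X p γ := by
  have hp0 : 0 < p := by linarith
  -- `δ` is chosen such that the good-`λ` inequality has the factor `2 ^ (-p) / 2`
  obtain ⟨δ, hδ, hδ1, hδ2⟩ : ∃ δ : ℝ, 0 < δ ∧ 4 * δ ≤ 1 ∧ (8 * β * δ) ^ q ≤ (2 ^ p)⁻¹ / 2 := by
    have hc : Continuous fun δ : ℝ => (8 * β * δ) ^ q :=
      (Real.continuous_rpow_const hq.le).comp (by fun_prop)
    have h1 : ∀ᶠ δ in 𝓝 (0 : ℝ), (8 * β * δ) ^ q < (2 ^ p)⁻¹ / 2 := by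
      refine hc.continuousAt.eventually_lt continuousAt_const ?_
      rw [mul_zero, Real.zero_rpow hq.ne']
      positivity
    obtain ⟨δ, h1, h2, h3⟩ := (((h1.filter_mono nhdsWithin_le_nhds).and
      (Ioo_mem_nhdsGT (show (0 : ℝ) < 1 / 4 by norm_num))).exists : ∃ δ : ℝ, _)
    exact ⟨δ, h2, by linarith, h1.le⟩
  set K : ℝ := 2 * 2 ^ p * (δ⁻¹) ^ p * (2 * (2 * (p / (p - 1))) ^ p) with hK
  have hp1 : 0 < p - 1 := by linarith
  have hK0 : 0 < K := by positivity
  refine ⟨K ^ p⁻¹, by positivity, ?_⟩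
  intro Ω m μ _ ℱ d hd ⟨C, hC⟩ hpred ε hε n
  set x : Ω → ℕ → X := fun ω k => ∑ j ∈ Finset.range k, d (j + 1) ω with hx
  set y : Ω → ℕ → X := fun ω k => ∑ j ∈ Finset.range k, ε j • d (j + 1) ω with hy
  have hdm : ∀ k, StronglyMeasurable (d k) := fun k => (hd.adapted k).mono (ℱ.le k)
  have hxm : ∀ k, StronglyMeasurable fun ω => x ω k := fun k =>
    Finset.stronglyMeasurable_fun_sum _ fun j _ => hdm (j + 1)
  have hym : ∀ k, StronglyMeasurable fun ω => y ω k := fun k =>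
    Finset.stronglyMeasurable_fun_sum _ fun j _ => (hdm (j + 1)).const_smul (ε j)
  have hXm : StronglyMeasurable fun ω => runMax (x ω) n :=
    stronglyMeasurable_runMax (x := fun j ω => x ω j) fun j _ => (hxm j).norm
  have hYm : StronglyMeasurable fun ω => runMax (y ω) n :=
    stronglyMeasurable_runMax (x := fun j ω => y ω j) fun j _ => (hym j).norm
  have hC0 : 0 ≤ C := by
    obtain ⟨ω⟩ := nonempty_of_isProbabilityMeasure μ
    exact (norm_nonneg _).trans (hC 0 ω)
  have hxb : ∀ k ω, ‖x ω k‖ ≤ k * C := fun k ω => by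
    refine (norm_sum_le_of_le _ fun j _ => hC (j + 1) ω).trans ?_
    simp
  have hyb : ∀ k ω, ‖y ω k‖ ≤ k * C := fun k ω => by
    refine (norm_sum_le_of_le (f := fun j => ε j • d (j + 1) ω) _ fun j _ => ?_).trans
      (b := ∑ j ∈ Finset.range k, C) ?_
    · rw [norm_smul, hε, one_mul]
      exact hC (j + 1) ω
    · simp
  have hbound : ∀ {f : Ω → ℝ}, StronglyMeasurable f → (∀ ω, 0 ≤ f ω) → (∀ ω, f ω ≤ n * C) →
      Integrable (fun ω => f ω ^ p) μ := fun {f} hf h0 h1 =>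
    (MemLp.of_bound ((Real.continuous_rpow_const hp0.le).comp_stronglyMeasurable
      hf).aestronglyMeasurable ((n * C) ^ p) (ae_of_all _ fun ω => by
        rw [Real.norm_of_nonneg (Real.rpow_nonneg (h0 ω) _)]
        exact Real.rpow_le_rpow (h0 ω) (h1 ω) hp0.le) (p := 1)).integrable le_rfl
  have hXi := hbound hXm (fun ω => runMax_nonneg _ _) fun ω => runMax_le_iff.2 fun j hj =>
    (hxb j ω).trans (by gcongr)
  have hYi := hbound hYm (fun ω => runMax_nonneg _ _) fun ω => runMax_le_iff.2 fun j hj =>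
    (hyb j ω).trans (by gcongr)
  have hxi := hbound (hxm n).norm (fun ω => norm_nonneg _) (hxb n)
  have hyi := hbound (hym n).norm (fun ω => norm_nonneg _) (hyb n)
  -- integration of the good-`λ` inequality against `p r ^ (p - 1) dr`
  have hlayer : ∀ {f : Ω → ℝ}, StronglyMeasurable f → (∀ ω, 0 ≤ f ω) →
      ∫⁻ ω, ENNReal.ofReal (f ω ^ p) ∂μ = ENNReal.ofReal p *
        ∫⁻ t in Set.Ioi 0, μ {ω | t < f ω} * ENNReal.ofReal (t ^ (p - 1)) := fun hf h0 =>
    lintegral_rpow_eq_lintegral_meas_lt_mul μ (ae_of_all _ h0) hf.measurable.aemeasurable hp0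
  have hgood : ∫⁻ ω, ENNReal.ofReal ((runMax (y ω) n / 2) ^ p) ∂μ ≤
      ∫⁻ ω, ENNReal.ofReal ((δ⁻¹ * runMax (x ω) n) ^ p) ∂μ +
      ENNReal.ofReal ((8 * β * δ) ^ q) * ∫⁻ ω, ENNReal.ofReal (runMax (y ω) n ^ p) ∂μ := by
    rw [hlayer (f := fun ω => runMax (y ω) n / 2) (hYm.div stronglyMeasurable_const) fun ω =>
        div_nonneg (runMax_nonneg _ _) zero_le_two,
      hlayer (hXm.const_mul δ⁻¹) fun ω => mul_nonneg (inv_nonneg.2 hδ.le) (runMax_nonneg _ _),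
      hlayer hYm fun ω => runMax_nonneg _ _, mul_left_comm, ← mul_add]
    have hmeas : ∀ f : Ω → ℝ, Measurable fun t : ℝ =>
        μ {ω | t < f ω} * ENNReal.ofReal (t ^ (p - 1)) :=
      fun f => by
        have h1 : Antitone fun t : ℝ => μ {ω | t < f ω} := fun s t hst =>
          measure_mono fun ω hω => lt_of_le_of_lt hst hω
        have h2 : Measurable fun t : ℝ => ENNReal.ofReal (t ^ (p - 1)) := by fun_prop
        exact h1.measurable.mul h2
    rw [← lintegral_const_mul (ENNReal.ofReal ((8 * β * δ) ^ q)) (hmeas _),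
      ← lintegral_add_left (hmeas _)]
    refine mul_le_mul_right ?_ _
    refine setLIntegral_mono' measurableSet_Ioi fun t ht => ?_
    have h1 := h.good_lambda hq hβ hd hC hpred hε n hδ hδ1 (r := t) ht
    have e1 : {ω | t < runMax (y ω) n / 2} = {ω | 2 * t < runMax (y ω) n} := by
      ext ω
      simp only [Set.mem_ofPred_eq, lt_div_iff₀ (zero_lt_two (α := ℝ)), mul_comm t]
    have e2 : {ω | t < δ⁻¹ * runMax (x ω) n} = {ω | δ * t < runMax (x ω) n} := by
      ext ω
      simp only [Set.mem_ofPred_eq, lt_inv_mul_iff₀ hδ]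
    rw [e1, e2, ← mul_assoc, ← add_mul]
    gcongr
  have hX0 : ∀ ω, 0 ≤ runMax (x ω) n := fun ω => runMax_nonneg _ _
  have hY0 : ∀ ω, 0 ≤ runMax (y ω) n := fun ω => runMax_nonneg _ _
  have hreal : (2 ^ p)⁻¹ * ∫ ω, runMax (y ω) n ^ p ∂μ ≤
      δ⁻¹ ^ p * ∫ ω, runMax (x ω) n ^ p ∂μ +
        (8 * β * δ) ^ q * ∫ ω, runMax (y ω) n ^ p ∂μ := by
    have e1 : ∀ ω, (runMax (y ω) n / 2) ^ p = (2 ^ p)⁻¹ * runMax (y ω) n ^ p := fun ω => by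
      rw [Real.div_rpow (hY0 ω) zero_le_two, div_eq_inv_mul]
    have e2 : ∀ ω, (δ⁻¹ * runMax (x ω) n) ^ p = δ⁻¹ ^ p * runMax (x ω) n ^ p := fun ω =>
      Real.mul_rpow (inv_nonneg.2 hδ.le) (hX0 ω)
    simp only [e1, e2] at hgood
    have i1 : 0 ≤ ∫ ω, runMax (y ω) n ^ p ∂μ :=
      integral_nonneg fun ω => Real.rpow_nonneg (hY0 ω) _
    have i2 : 0 ≤ ∫ ω, runMax (x ω) n ^ p ∂μ :=
      integral_nonneg fun ω => Real.rpow_nonneg (hX0 ω) _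
    rw [← ofReal_integral_eq_lintegral_ofReal (hYi.const_mul _) (ae_of_all _ fun ω =>
        mul_nonneg (by positivity) (Real.rpow_nonneg (hY0 ω) _)),
      ← ofReal_integral_eq_lintegral_ofReal (hXi.const_mul _) (ae_of_all _ fun ω =>
        mul_nonneg (by positivity) (Real.rpow_nonneg (hX0 ω) _)),
      ← ofReal_integral_eq_lintegral_ofReal hYi (ae_of_all _ fun ω =>
        Real.rpow_nonneg (hY0 ω) _), ← ENNReal.ofReal_mul (by positivity),
      ← ENNReal.ofReal_add (integral_nonneg fun ω => mul_nonneg (by positivity)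
        (Real.rpow_nonneg (hX0 ω) _)) (by positivity),
      integral_const_mul, integral_const_mul,
      ENNReal.ofReal_le_ofReal_iff (by positivity)] at hgood
    exact hgood
  have hdoob : ∫ ω, runMax (x ω) n ^ p ∂μ ≤
      2 * (2 * (p / (p - 1))) ^ p * ∫ ω, ‖x ω n‖ ^ p ∂μ := integral_runMax_rpow_le hd hC hp n
  have hY : ∫ ω, runMax (y ω) n ^ p ∂μ ≤ K * ∫ ω, ‖x ω n‖ ^ p ∂μ := by
    have i1 : 0 ≤ ∫ ω, runMax (y ω) n ^ p ∂μ :=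
      integral_nonneg fun ω => Real.rpow_nonneg (hY0 ω) _
    have h1 := mul_le_mul_of_nonneg_right hδ2 i1
    have h2 : (2 ^ p)⁻¹ / 2 * ∫ ω, runMax (y ω) n ^ p ∂μ ≤
        δ⁻¹ ^ p * (2 * (2 * (p / (p - 1))) ^ p * ∫ ω, ‖x ω n‖ ^ p ∂μ) := by
      have h3 := mul_le_mul_of_nonneg_left hdoob (by positivity : 0 ≤ δ⁻¹ ^ p)
      linarith
    have h4 := mul_le_mul_of_nonneg_left h2 (by positivity : (0 : ℝ) ≤ 2 * 2 ^ p)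
    have h5 : (2 : ℝ) * 2 ^ p * ((2 ^ p)⁻¹ / 2 * ∫ ω, runMax (y ω) n ^ p ∂μ) =
        ∫ ω, runMax (y ω) n ^ p ∂μ := by
      have : (2 : ℝ) ^ p ≠ 0 := by positivity
      field_simp
    rw [h5] at h4
    refine h4.trans_eq ?_
    rw [hK]
    ring
  have hfin : ∫ ω, ‖y ω n‖ ^ p ∂μ ≤ K * ∫ ω, ‖x ω n‖ ^ p ∂μ :=
    (integral_mono hyi hYi fun ω => Real.rpow_le_rpow (norm_nonneg _)
      (norm_le_runMax _ le_rfl) hp0.le).trans hY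
  rw [lintegral_enorm_rpow_eq hp0.le hyi, lintegral_enorm_rpow_eq hp0.le hxi,
    ENNReal.ofReal_rpow_of_nonneg (by positivity) hp0.le, ← Real.rpow_mul hK0.le,
    inv_mul_cancel₀ hp0.ne', Real.rpow_one, ← ENNReal.ofReal_mul hK0.le]
  exact ENNReal.ofReal_le_ofReal hfin

end GoodLambda

/-! ### Best constants and convergence of transforms -/

section Constants

variable {𝕜 : Type u} [RCLike 𝕜] {X : Type v} [NormedAddCommGroup X] [NormedSpace 𝕜 X]
  {p β : ℝ}

theorem ZigzagTree.continuous_val (hp : 0 ≤ p) (t : ZigzagTree 𝕜 X) (x y : X) :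
    Continuous fun β : ℝ => t.val (powerPayoff p β) x y := by
  induction t generalizing x y with
  | leaf =>
    have := Real.continuous_rpow_const hp
    simp only [val, powerPayoff]
    fun_prop
  | node z e l r hl hr => exact ((hl _ _).add (hr _ _)).div_const 2

theorem isClosed_zigzagBound (hp : 0 ≤ p) :
    IsClosed {β : ℝ | 0 ≤ β ∧ ZigzagBound 𝕜 X p β} := by
  refine isClosed_Ici.inter ?_
  have : {β : ℝ | ZigzagBound 𝕜 X p β} =
      ⋂ t : ZigzagTree 𝕜 X, {β | t.val (powerPayoff p β) 0 0 ≤ 0} := by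
    ext β
    simp [ZigzagBound]
  change IsClosed {β : ℝ | ZigzagBound 𝕜 X p β}
  rw [this]
  exact isClosed_iInter fun t => isClosed_le (t.continuous_val hp 0 0) continuous_const

/-- The constant `0` is admissible only for the trivial space. -/
theorem ZigzagBound.eq_zero (hp : 0 < p) (h : ZigzagBound 𝕜 X p 0) (z : X) : z = 0 := by
  have := h (.node z ⟨1, by simp⟩ .leaf .leaf)
  simp only [ZigzagTree.val, powerPayoff, Real.zero_rpow hp.ne', zero_add, zero_mul, sub_zero,
    one_smul, zero_sub, norm_neg, add_self_div_two] at this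
  have h1 : 0 ≤ ‖z‖ ^ p := by positivity
  have h2 := (Real.rpow_eq_zero (norm_nonneg z) hp.ne').1 (le_antisymm this h1)
  exact norm_eq_zero.1 h2

/-- The case of an infinite right-hand side. It is not vacuous for `β = 0`, where `0 * ∞ = 0`; but
then the space is trivial. -/
theorem ZigzagBound.lintegral_le_of_eq_top (hp : 0 < p) (hβ : 0 ≤ β) (h : ZigzagBound 𝕜 X p β)
    {Ω : Type*} {m : MeasurableSpace Ω} {μ : Measure Ω} {f : Ω → X} (g : Ω → X)
    (hf : ∫⁻ ω, ‖f ω‖ₑ ^ p ∂μ = ∞) :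
    ∫⁻ ω, ‖g ω‖ₑ ^ p ∂μ ≤ ENNReal.ofReal β ^ p * ∫⁻ ω, ‖f ω‖ₑ ^ p ∂μ := by
  rcases hβ.eq_or_lt with rfl | hβ
  · have : ∀ ω, g ω = 0 := fun ω => h.eq_zero hp _
    simp [this, hp]
  · rw [hf, ENNReal.mul_top]
    · exact le_top
    · have : 0 < ENNReal.ofReal β := ENNReal.ofReal_pos.2 hβ
      exact (ENNReal.rpow_pos this ENNReal.ofReal_ne_top).ne'

end Constants

section MartingaleDiff

variable {𝕜 : Type u} [RCLike 𝕜] {X : Type v} [NormedAddCommGroup X] [NormedSpace 𝕜 X]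
  [NormedSpace ℝ X] [IsScalarTower ℝ 𝕜 X] [CompleteSpace X] {p β : ℝ}

omit [NormedSpace 𝕜 X] [IsScalarTower ℝ 𝕜 X] in
/-- If the sum of martingale differences is in `L^p`, so are its terms. -/
theorem memLp_of_memLp_sum {Ω : Type*} {m : MeasurableSpace Ω} {μ : Measure Ω}
    [IsProbabilityMeasure μ] {ℱ : Filtration ℕ m} {d : ℕ → Ω → X} {n : ℕ} {q : ℝ≥0∞} (hq : 1 ≤ q)
    (hd : ∀ k < n, StronglyMeasurable[ℱ k] (d k)) (hi : ∀ k < n, Integrable (d k) μ)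
    (h0 : ∀ k, k + 1 < n → ∀ A, MeasurableSet[ℱ k] A → ∫ ω in A, d (k + 1) ω ∂μ = 0)
    (hS : MemLp (fun ω => ∑ k ∈ Finset.range n, d k ω) q μ) {k : ℕ} (hk : k < n) :
    MemLp (d k) q μ := by
  have hSi : ∀ j ≤ n, Integrable (fun ω => ∑ i ∈ Finset.range j, d i ω) μ := fun j hj =>
    integrable_finsetSum _ fun i hi' => hi i ((Finset.mem_range.1 hi').trans_le hj)
  have hint : ∀ j l, j + l + 1 ≤ n → ∀ A, MeasurableSet[ℱ j] A →
      ∫ ω in A, ∑ i ∈ Finset.range (j + l + 1), d i ω ∂μ =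
        ∫ ω in A, ∑ i ∈ Finset.range (j + 1), d i ω ∂μ := by
    intro j l
    induction l with
    | zero => exact fun _ _ _ => rfl
    | succ l ih =>
      intro hl A hA
      rw [← ih (by omega) A hA]
      have e : j + (l + 1) + 1 = j + l + 1 + 1 := by ring
      simp only [e, Finset.sum_range_succ _ (j + l + 1)]
      rw [integral_add (hSi _ (by omega)).integrableOn (hi _ (by omega)).integrableOn,
        h0 _ (by omega) A (ℱ.mono (Nat.le_add_right j l) A hA), add_zero]
  have hpart : ∀ j < n, MemLp (fun ω => ∑ i ∈ Finset.range (j + 1), d i ω) q μ := fun j hj => by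
    have h1 : (fun ω => ∑ i ∈ Finset.range (j + 1), d i ω) =ᵐ[μ]
        μ[fun ω => ∑ i ∈ Finset.range n, d i ω | ℱ j] := by
      refine ae_eq_condExp_of_forall_setIntegral_eq (ℱ.le j) (hSi n le_rfl)
        (fun _ _ _ => (hSi _ hj).integrableOn) (fun A hA _ => ?_) ?_
      · have := hint j (n - j - 1) (by omega) A hA
        rw [show j + (n - j - 1) + 1 = n by omega] at this
        exact this.symm
      · exact (Finset.stronglyMeasurable_fun_sum _ fun i hi' =>
          (hd i (by rw [Finset.mem_range] at hi'; omega)).mono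
            (ℱ.mono (by rw [Finset.mem_range] at hi'; omega))).aestronglyMeasurable
    exact (memLp_congr_ae h1).2 (hS.condExp hq)
  cases k with
  | zero => simpa using hpart 0 hk
  | succ k =>
    have := (hpart (k + 1) hk).sub (hpart k (by omega))
    refine (memLp_congr_ae (ae_of_all _ fun ω => ?_)).1 this
    simp [Finset.sum_range_succ _ (k + 1)]

/-- The `L^p` estimate for transforms, with `[0, ∞]`-valued expectations. -/
theorem IsTransformUpTo.lintegral_le_of_integrable {Ω : Type*} {m : MeasurableSpace Ω}
    {μ : Measure Ω} [IsProbabilityMeasure μ] {ℱ : Filtration ℕ m} {d e : ℕ → Ω → X} {n : ℕ}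
    (h : IsTransformUpTo 𝕜 e d ℱ μ n) (hp : 1 ≤ p) (hβ : 0 ≤ β) (h0 : ZigzagBound 𝕜 X p β)
    (hd : ∀ k < n, Integrable (d k) μ) :
    ∫⁻ ω, ‖∑ k ∈ Finset.range n, e k ω‖ₑ ^ p ∂μ ≤
      ENNReal.ofReal β ^ p * ∫⁻ ω, ‖∑ k ∈ Finset.range n, d k ω‖ₑ ^ p ∂μ := by
  have hp0 : 0 < p := by linarith
  by_cases htop : ∫⁻ ω, ‖∑ k ∈ Finset.range n, d k ω‖ₑ ^ p ∂μ = ∞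
  · exact h0.lintegral_le_of_eq_top hp0 hβ _ htop
  have hS : MemLp (fun ω => ∑ k ∈ Finset.range n, d k ω) (ENNReal.ofReal p) μ := by
    refine ⟨(integrable_finsetSum _ fun k hk =>
      hd k (Finset.mem_range.1 hk)).aestronglyMeasurable, ?_⟩
    rw [eLpNorm_lt_top_iff_lintegral_rpow_enorm_lt_top (by simpa using hp0) ENNReal.ofReal_ne_top,
      ENNReal.toReal_ofReal hp0.le]
    exact lt_top_iff_ne_top.2 htop
  exact h.lintegral_le hp hβ h0 fun k hk => memLp_of_memLp_sum
    (by simpa using ENNReal.ofReal_le_ofReal hp) h.adapted hd h.setIntegral_succ hS hk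

omit [IsScalarTower ℝ 𝕜 X] in
theorem IsMartingaleDiff.isTransformUpTo {Ω : Type*} {m : MeasurableSpace Ω} {μ : Measure Ω}
    [IsProbabilityMeasure μ] {ℱ : Filtration ℕ m} {d e : ℕ → Ω → X} (hd : IsMartingaleDiff d ℱ μ)
    (he : IsMartingaleDiff e ℱ μ) (h : ∀ k, ∀ᵐ ω ∂μ, ∃ a : 𝕜, ‖a‖ ≤ 1 ∧ e k ω = a • d k ω) (n : ℕ) :
    IsTransformUpTo 𝕜 e d ℱ μ n where
  adapted k _ := hd.adapted k
  adapted' k _ := he.adapted k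
  setIntegral_succ k _ _ hA :=
    setIntegral_eq_zero_of_condExp (ℱ.le k) (hd.integrable _) (hd.condExp_succ k) hA
  setIntegral_succ' k _ _ hA :=
    setIntegral_eq_zero_of_condExp (ℱ.le k) (he.integrable _) (he.condExp_succ k) hA
  exists_smul k _ := h k

omit [NormedSpace 𝕜 X] [IsScalarTower ℝ 𝕜 X] in
/-- The martingale differences from time `n` on. -/
theorem IsMartingaleDiff.tail {Ω : Type*} {m : MeasurableSpace Ω} {μ : Measure Ω}
    {ℱ : Filtration ℕ m} {d : ℕ → Ω → X} (hd : IsMartingaleDiff d ℱ μ) (n : ℕ) :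
    IsMartingaleDiff (fun k => if n ≤ k then d k else 0) ℱ μ := by
  refine ⟨fun k => ?_, fun k => ?_, fun k => ?_⟩
  · simp only
    split_ifs
    · exact hd.adapted k
    · exact stronglyMeasurable_zero
  · split_ifs
    · exact hd.integrable k
    · exact integrable_zero _ _ _
  · split_ifs
    · exact hd.condExp_succ k
    · rw [condExp_zero]

theorem IsMartingaleDiff.smul {Ω : Type*} {m : MeasurableSpace Ω} {μ : Measure Ω}
    [IsProbabilityMeasure μ] {ℱ : Filtration ℕ m} {d : ℕ → Ω → X} (hd : IsMartingaleDiff d ℱ μ)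
    (ε : ℕ → 𝕜) : IsMartingaleDiff (fun k ω => ε k • d k ω) ℱ μ := by
  refine ⟨fun k => (hd.adapted k).const_smul _, fun k => (hd.integrable k).smul _, fun k => ?_⟩
  refine condExp_ae_eq_zero (ℱ.le k) ((hd.integrable _).smul _) fun A hA => ?_
  rw [integral_smul, setIntegral_eq_zero_of_condExp (ℱ.le k) (hd.integrable _)
    (hd.condExp_succ k) hA, smul_zero]

theorem sum_Icc_one_eq_sum_range {M : Type*} [AddCommMonoid M] (f : ℕ → M) (n : ℕ) :
    ∑ j ∈ Finset.Icc 1 n, f j = ∑ j ∈ Finset.range n, f (j + 1) := by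
  rw [Finset.range_eq_Ico, Finset.sum_Ico_add' f 0 n 1]
  rfl

theorem ZigzagBound.umdBound (hp : 1 ≤ p) (hβ : 0 ≤ β) (h : ZigzagBound 𝕜 X p β) :
    UMDBound.{u, v, w} 𝕜 X p β := by
  intro Ω m μ _ ℱ d hd _ ε hε n _
  rw [eLpNorm_le_ofReal_mul_iff (by linarith)]
  -- `UMDBound` ignores the term `d 0`
  have hd' := hd.tail 1
  have key := (hd'.isTransformUpTo (hd'.smul ε) (fun k => ae_of_all _ fun ω =>
    ⟨ε k, (hε k).le, rfl⟩) (n + 1)).lintegral_le_of_integrable hp hβ h fun k _ => hd'.integrable k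
  simpa [Finset.sum_range_succ', sum_Icc_one_eq_sum_range] using key

theorem umdBound_iff_zigzagBound (hp : 1 ≤ p) (hβ : 0 ≤ β) :
    UMDBound.{u, v, w} 𝕜 X p β ↔ ZigzagBound 𝕜 X p β :=
  ⟨fun h => (h.predictable (by linarith)).zigzagBound (by linarith) hβ, fun h => h.umdBound hp hβ⟩

omit [IsScalarTower ℝ 𝕜 X] in
theorem IsUMD.exists_zigzagBound (h : IsUMD.{u, v, w} 𝕜 X) (hp : 1 < p) :
    ∃ β : ℝ, 0 < β ∧ ZigzagBound 𝕜 X p β := by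
  obtain ⟨q, hq, β, hβ, hb⟩ := h
  obtain ⟨γ, hγ, hg⟩ := (hb.predictable (by linarith)).exists_of_exponent (by linarith) hβ.le hp
  exact ⟨γ, hγ, hg.zigzagBound (by linarith) hγ.le⟩

/-- The infimum that defines the UMD constant is attained, and it is an infimum of the constants of
`ZigzagBound`. -/
theorem IsUMD.umdConst_mem (h : IsUMD.{u, v, w} 𝕜 X) (hp : 1 < p) :
    0 ≤ umdConst.{u, v, w} 𝕜 X p ∧ ZigzagBound 𝕜 X p (umdConst.{u, v, w} 𝕜 X p) := by
  have hset : {β : ℝ | 0 ≤ β ∧ UMDBound.{u, v, w} 𝕜 X p β} =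
      {β : ℝ | 0 ≤ β ∧ ZigzagBound 𝕜 X p β} := by
    ext β
    exact and_congr_right fun hβ => umdBound_iff_zigzagBound hp.le hβ
  rw [umdConst, hset]
  obtain ⟨β, hβ, hb⟩ := h.exists_zigzagBound hp
  exact (isClosed_zigzagBound (by linarith)).csInf_mem ⟨β, hβ.le, hb⟩ ⟨0, fun _ h => h.1⟩

/-- Transforms of `L^p`-convergent sums converge in `L^p`: the estimate for the blocks of
differences shows that the transformed partial sums are a Cauchy sequence. -/
theorem ZigzagBound.exists_limit (hp : 1 ≤ p) (hβ : 0 ≤ β) (h : ZigzagBound 𝕜 X p β) {Ω : Type*}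
    {m : MeasurableSpace Ω} {μ : Measure Ω} [IsProbabilityMeasure μ] {ℱ : Filtration ℕ m}
    {d e : ℕ → Ω → X} (hd : IsMartingaleDiff d ℱ μ) (he : IsMartingaleDiff e ℱ μ)
    (hde : ∀ k, ∀ᵐ ω ∂μ, ∃ a : 𝕜, ‖a‖ ≤ 1 ∧ e k ω = a • d k ω) {D : Ω → X}
    (hD : MemLp D (ENNReal.ofReal p) μ)
    (hlim : Tendsto (fun n => eLpNorm (fun ω => (∑ k ∈ Finset.range n, d k ω) - D ω)
      (ENNReal.ofReal p) μ) atTop (𝓝 0)) :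
    ∃ S : Ω → X, MemLp S (ENNReal.ofReal p) μ ∧
      Tendsto (fun n => eLpNorm (fun ω => (∑ k ∈ Finset.range n, e k ω) - S ω)
        (ENNReal.ofReal p) μ) atTop (𝓝 0) ∧
      ∫⁻ ω, ‖S ω‖ₑ ^ p ∂μ ≤ ENNReal.ofReal β ^ p * ∫⁻ ω, ‖D ω‖ₑ ^ p ∂μ := by
  have hp0 : 0 < p := by linarith
  have hp1 : 1 ≤ ENNReal.ofReal p := by simpa using ENNReal.ofReal_le_ofReal hp
  have : Fact (1 ≤ ENNReal.ofReal p) := ⟨hp1⟩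
  set s : ℕ → Ω → X := fun n ω => ∑ k ∈ Finset.range n, d k ω with hs
  set t : ℕ → Ω → X := fun n ω => ∑ k ∈ Finset.range n, e k ω with ht
  have hdL : ∀ k, MemLp (d k) (ENNReal.ofReal p) μ := fun k => by
    have h1 : ∀ᶠ n in atTop, eLpNorm (fun ω => s n ω - D ω) (ENNReal.ofReal p) μ < 1 :=
      hlim.eventually (Iio_mem_nhds one_pos)
    obtain ⟨n, hn, hkn⟩ := (h1.and (eventually_gt_atTop k)).exists
    have h2 : MemLp (fun ω => s n ω - D ω) (ENNReal.ofReal p) μ :=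
      ⟨(integrable_finsetSum _ fun k _ => hd.integrable k).aestronglyMeasurable.sub
        hD.aestronglyMeasurable, hn.trans ENNReal.one_lt_top⟩
    have h3 : MemLp (s n) (ENNReal.ofReal p) μ :=
      (memLp_congr_ae (ae_of_all _ fun ω => by simp)).1 (h2.add hD)
    have h4 := hd.isTransformUpTo he hde n
    exact memLp_of_memLp_sum hp1 h4.adapted (fun k _ => hd.integrable k) h4.setIntegral_succ h3 hkn
  have heL : ∀ k, MemLp (e k) (ENNReal.ofReal p) μ := fun k => by
    refine (hdL k).mono (he.integrable k).aestronglyMeasurable ?_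
    filter_upwards [hde k] with ω ⟨a, ha, hae⟩
    rw [hae, norm_smul]
    exact mul_le_of_le_one_left (norm_nonneg _) ha
  have hsL : ∀ n, MemLp (s n) (ENNReal.ofReal p) μ := fun n => memLp_finsetSum _ fun k _ => hdL k
  have htL : ∀ n, MemLp (t n) (ENNReal.ofReal p) μ := fun n => memLp_finsetSum _ fun k _ => heL k
  have hblock : ∀ k n, k ≤ n → eLpNorm (t n - t k) (ENNReal.ofReal p) μ ≤
      ENNReal.ofReal β * eLpNorm (s n - s k) (ENNReal.ofReal p) μ := fun k n hkn => by
    rw [eLpNorm_le_ofReal_mul_iff hp0]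
    have key := ((hd.tail k).isTransformUpTo (𝕜 := 𝕜) (he.tail k) (fun j => by
      split_ifs
      · exact hde j
      · exact ae_of_all _ fun ω => ⟨0, by simp, by simp⟩) n).lintegral_le_of_integrable hp hβ h
      fun j _ => (hd.tail k).integrable j
    have hsum : ∀ (c : ℕ → Ω → X) ω, ∑ j ∈ Finset.range n, (if k ≤ j then c j else 0) ω =
        ∑ j ∈ Finset.range n, c j ω - ∑ j ∈ Finset.range k, c j ω := fun c ω => by
      rw [← Finset.sum_Ico_eq_sub _ hkn]
      simp only [apply_ite (fun g : Ω → X => g ω), Pi.zero_apply]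
      rw [← Finset.sum_filter]
      refine Finset.sum_congr ?_ fun _ _ => rfl
      ext j
      simp [and_comm]
    simp only [hsum] at key
    exact key
  let F : ℕ → Lp X (ENNReal.ofReal p) μ := fun n => (htL n).toLp (t n)
  let G : ℕ → Lp X (ENNReal.ofReal p) μ := fun n => (hsL n).toLp (s n)
  have hG : Tendsto G atTop (𝓝 (hD.toLp D)) :=
    (Lp.tendsto_Lp_iff_tendsto_eLpNorm'' s hsL D hD).2 hlim
  have hFG : ∀ k n, k ≤ n → dist (F k) (F n) ≤ β * dist (G k) (G n) := fun k n hkn => by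
    have h1 := hblock k n hkn
    rw [← Lp.edist_toLp_toLp _ _ (htL n) (htL k), ← Lp.edist_toLp_toLp _ _ (hsL n) (hsL k),
      edist_dist, edist_dist, ← ENNReal.ofReal_mul hβ,
      ENNReal.ofReal_le_ofReal_iff (by positivity)] at h1
    rwa [dist_comm (F k), dist_comm (G k)]
  have hFG' : ∀ k n, dist (F k) (F n) ≤ β * dist (G k) (G n) := fun k n => by
    rcases le_total k n with hkn | hkn
    · exact hFG k n hkn
    · rw [dist_comm (F k), dist_comm (G k)]
      exact hFG n k hkn
  have hF : CauchySeq F := by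
    refine Metric.cauchySeq_iff.2 fun ε hε => ?_
    obtain ⟨N, hN⟩ := Metric.cauchySeq_iff.1 hG.cauchySeq (ε / (β + 1)) (by positivity)
    refine ⟨N, fun k hk n hn => ?_⟩
    have h1 := hN k hk n hn
    rw [lt_div_iff₀ (by positivity)] at h1
    nlinarith [hFG' k n, dist_nonneg (x := G k) (y := G n)]
  obtain ⟨S, hS⟩ := cauchySeq_tendsto_of_complete hF
  have hSS : (Lp.memLp S).toLp S = S := Lp.toLp_coeFn S _
  refine ⟨S, Lp.memLp S, ?_, ?_⟩
  · exact (Lp.tendsto_Lp_iff_tendsto_eLpNorm'' t htL S (Lp.memLp S)).1 (by rwa [hSS])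
  · rw [← eLpNorm_le_ofReal_mul_iff hp0, ← Lp.enorm_toLp (Lp.memLp S), ← Lp.enorm_toLp hD, hSS]
    have hn : ∀ n, ‖F n‖ₑ ≤ ENNReal.ofReal β * ‖G n‖ₑ := fun n => by
      have h1 := hblock 0 n n.zero_le
      have e1 : t n - t 0 = t n := by funext ω; simp [ht]
      have e2 : s n - s 0 = s n := by funext ω; simp [hs]
      rwa [e1, e2, ← Lp.enorm_toLp (htL n), ← Lp.enorm_toLp (hsL n)] at h1
    exact le_of_tendsto_of_tendsto' hS.enorm
      (ENNReal.Tendsto.const_mul hG.enorm (Or.inr ENNReal.ofReal_ne_top)) hn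

end MartingaleDiff

/-! ### Weak differential subordination and scalar multipliers -/

section Multiplier

variable {𝕜 : Type u} [RCLike 𝕜] {X : Type v} [NormedAddCommGroup X] [NormedSpace 𝕜 X]

variable (𝕜) in
theorem TopologicalSpace.IsSeparable.exists_separating_seq {t : Set X}
    (ht : TopologicalSpace.IsSeparable t) :
    ∃ φ : ℕ → StrongDual 𝕜 X, ∀ x ∈ t, (∀ k, φ k x = 0) → x = 0 := by
  obtain ⟨d, hd, hdt⟩ := ht
  obtain ⟨z, hz⟩ := (hd.insert 0).exists_eq_range (Set.insert_nonempty 0 d)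
  choose φ hφ hφz using fun k => exists_dual_vector'' 𝕜 (z k)
  refine ⟨φ, fun x hx h => ?_⟩
  by_contra hx0
  have hpos : 0 < ‖x‖ / 2 := by positivity
  obtain ⟨y, hy, hxy⟩ := Metric.mem_closure_iff.1 (hdt hx) _ hpos
  obtain ⟨k, rfl⟩ : y ∈ Set.range z := hz ▸ Set.mem_insert_of_mem 0 hy
  have h1 : ‖z k‖ ≤ ‖z k - x‖ := by
    have h2 := (φ k).le_of_opNorm_le (hφ k) (z k - x)
    rwa [map_sub, h k, sub_zero, hφz, RCLike.norm_coe_norm, one_mul] at h2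
  rw [dist_eq_norm'] at hxy
  have h3 := norm_sub_norm_le x (z k)
  rw [norm_sub_rev] at h3
  linarith

/-- If `y` is dominated by `x` under every functional, outside a null set that may depend on the
functional, then `y = a x` with `|a| ≤ 1`. For a sequence `φ` separating the values of `x`, the
multiplier is `a = φ k y / φ k x` for the first `k` with `φ k x ≠ 0`. Domination under the
functionals `φ' - c φ k` for `c` in a countable dense set, hence for all `c`, gives
`φ' y = a φ' x` upon choosing `c = φ' x / φ k x`. -/
theorem exists_multiplier {Ω : Type*} {m' m : MeasurableSpace Ω} {μ : Measure Ω}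
    {x y : Ω → X} (hx : StronglyMeasurable[m'] x) (hy : StronglyMeasurable[m'] y)
    (h : ∀ φ : StrongDual 𝕜 X, ∀ᵐ ω ∂μ, ‖φ (y ω)‖ ≤ ‖φ (x ω)‖) :
    ∃ a : Ω → 𝕜, StronglyMeasurable[m'] a ∧ (∀ᵐ ω ∂μ, ‖a ω‖ ≤ 1) ∧
      ∀ᵐ ω ∂μ, y ω = a ω • x ω := by
  classical
  obtain ⟨φ, hφ⟩ := hx.isSeparable_range.exists_separating_seq 𝕜
  have hex : ∀ ω, ∃ k, φ k (x ω) ≠ 0 ∨ ∀ j, φ j (x ω) = 0 := fun ω => by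
    by_cases h0 : ∀ j, φ j (x ω) = 0
    · exact ⟨0, Or.inr h0⟩
    · push Not at h0
      obtain ⟨k, hk⟩ := h0
      exact ⟨k, Or.inl hk⟩
  have hmx : ∀ k, Measurable[m'] fun ω => φ k (x ω) := fun k =>
    ((φ k).continuous.comp_stronglyMeasurable hx).measurable
  have hmy : ∀ k, Measurable[m'] fun ω => φ k (y ω) := fun k =>
    ((φ k).continuous.comp_stronglyMeasurable hy).measurable
  set κ : Ω → ℕ := fun ω => Nat.find (hex ω) with hκ
  set a : Ω → 𝕜 := fun ω => φ (κ ω) (y ω) / φ (κ ω) (x ω) with ha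
  have hma : Measurable[m'] a := by
    refine Measurable.find (f := fun k ω => φ k (y ω) / φ k (x ω))
      (p := fun k ω => φ k (x ω) ≠ 0 ∨ ∀ j, φ j (x ω) = 0)
      (fun k => (hmy k).div (hmx k)) (fun k => ?_) hex
    have h0 : ∀ k, MeasurableSet[m'] {ω | φ k (x ω) = 0} := fun k =>
      hmx k (measurableSet_singleton 0)
    have : {ω | φ k (x ω) ≠ 0 ∨ ∀ j, φ j (x ω) = 0} =
        {ω | φ k (x ω) = 0}ᶜ ∪ ⋂ j, {ω | φ j (x ω) = 0} := by
      ext ω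
      simp
    rw [this]
    exact (h0 k).compl.union (MeasurableSet.iInter h0)
  refine ⟨a, hma.stronglyMeasurable, ?_, ?_⟩
  · filter_upwards [ae_all_iff.2 fun k => h (φ k)] with ω hω
    rw [ha, norm_div]
    exact div_le_one_of_le₀ (hω _) (norm_nonneg _)
  · have hsep : StronglyMeasurable[m'] fun ω => y ω - a ω • x ω :=
      hy.sub (hma.stronglyMeasurable.smul hx)
    have hzero : (fun ω => y ω - a ω • x ω) =ᵐ[μ] 0 := by
      refine ae_eq_zero_of_forall_dual_of_isSeparable 𝕜 hsep.isSeparable_range (fun ψ => ?_)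
        (ae_of_all _ Set.mem_range_self)
      have hall : ∀ᵐ ω ∂μ, ∀ k n, ‖(ψ - TopologicalSpace.denseSeq 𝕜 n • φ k) (y ω)‖ ≤
          ‖(ψ - TopologicalSpace.denseSeq 𝕜 n • φ k) (x ω)‖ :=
        ae_all_iff.2 fun k => ae_all_iff.2 fun n => h _
      filter_upwards [hall] with ω hω
      have hc : ∀ c : 𝕜, ‖ψ (y ω) - c * φ (κ ω) (y ω)‖ ≤ ‖ψ (x ω) - c * φ (κ ω) (x ω)‖ := by
        have hcl : IsClosed
            {c : 𝕜 | ‖ψ (y ω) - c * φ (κ ω) (y ω)‖ ≤ ‖ψ (x ω) - c * φ (κ ω) (x ω)‖} :=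
          isClosed_le (by fun_prop) (by fun_prop)
        exact fun c => (TopologicalSpace.denseRange_denseSeq 𝕜).induction_on
          (p := fun c => ‖ψ (y ω) - c * φ (κ ω) (y ω)‖ ≤ ‖ψ (x ω) - c * φ (κ ω) (x ω)‖) c hcl
          fun n => by simpa using hω (κ ω) n
      have h1 := hc (ψ (x ω) / φ (κ ω) (x ω))
      have h2 : ψ (x ω) - ψ (x ω) / φ (κ ω) (x ω) * φ (κ ω) (x ω) = 0 := by
        rcases Nat.find_spec (hex ω) with h0 | h0
        · rw [div_mul_cancel₀ _ h0, sub_self]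
        · rw [hφ _ (Set.mem_range_self ω) h0]
          simp
      rw [h2, norm_zero, norm_le_zero_iff] at h1
      simp only [map_sub, map_smul, smul_eq_mul, Pi.zero_apply, ha]
      rw [← h1]
      ring
    filter_upwards [hzero] with ω hω
    exact sub_eq_zero.1 hω

theorem weaklyDiffSubordinate_iff {Ω : Type*} {m : MeasurableSpace Ω} {μ : Measure Ω}
    {ℱ : Filtration ℕ m} {f g : ℕ → Ω → X} (hf : StronglyAdapted ℱ f) (hg : StronglyAdapted ℱ g) :
    WeaklyDiffSubordinate 𝕜 g f μ ↔
      ∃ a : ℕ → Ω → 𝕜, StronglyAdapted ℱ a ∧ (∀ n, ∀ᵐ ω ∂μ, ‖a n ω‖ ≤ 1) ∧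
        (∀ᵐ ω ∂μ, g 0 ω = a 0 ω • f 0 ω) ∧
        ∀ n, ∀ᵐ ω ∂μ, g (n + 1) ω - g n ω = a (n + 1) ω • (f (n + 1) ω - f n ω) := by
  constructor
  · intro h
    obtain ⟨a₀, ha₀, hn₀, he₀⟩ := exists_multiplier (hf 0) (hg 0) h.zero
    choose a ha hn he using fun n => exists_multiplier
      ((hf (n + 1)).sub ((hf n).mono (ℱ.mono n.le_succ)))
      ((hg (n + 1)).sub ((hg n).mono (ℱ.mono n.le_succ))) (h.succ n)
    refine ⟨fun n => Nat.casesOn n a₀ a, fun n => ?_, fun n => ?_, he₀, he⟩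
    · cases n with
      | zero => exact ha₀
      | succ n => exact ha n
    · cases n with
      | zero => exact hn₀
      | succ n => exact hn n
  · rintro ⟨a, -, hn, h0, hs⟩
    have key : ∀ (φ : StrongDual 𝕜 X) (c : 𝕜) (x : X), ‖c‖ ≤ 1 → ‖φ (c • x)‖ ≤ ‖φ x‖ :=
      fun φ c x hc => by
        rw [map_smul, norm_smul]
        exact mul_le_of_le_one_left (norm_nonneg _) hc
    refine ⟨fun φ => ?_, fun n φ => ?_⟩
    · filter_upwards [hn 0, h0] with ω h1 h2
      rw [h2]
      exact key _ _ _ h1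
    · filter_upwards [hn (n + 1), hs n] with ω h1 h2
      rw [h2]
      exact key _ _ _ h1

end Multiplier

/-! ### Local martingales in discrete time -/

section LocalMartingale

variable {X : Type v} [NormedAddCommGroup X] [NormedSpace ℝ X] [CompleteSpace X]
  {Ω : Type w} {m : MeasurableSpace Ω} {μ : Measure Ω} {ℱ : Filtration ℕ m} {f : ℕ → Ω → X}

/-- On sets `B i ∈ ℱ k` increasing to `Ω` almost surely, namely `{k < τ i}` for a localizing
sequence `τ`, the pair `f k, f (k + 1)` behaves like two consecutive values of a martingale. -/
theorem IsLocalMartingale.exists_localizing_sets [IsFiniteMeasure μ] (h : IsLocalMartingale f ℱ μ)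
    (k : ℕ) :
    ∃ B : ℕ → Set Ω, (∀ i, MeasurableSet[ℱ k] (B i)) ∧
      (∀ᵐ ω ∂μ, ∀ᶠ i in atTop, ω ∈ B i) ∧
      ∀ i, IntegrableOn (f k) (B i) μ ∧ IntegrableOn (f (k + 1)) (B i) μ ∧
        ∀ A, MeasurableSet[ℱ k] A → ∫ ω in A ∩ B i, f (k + 1) ω ∂μ = ∫ ω in A ∩ B i, f k ω ∂μ := by
  obtain ⟨-, τ, hτ, hM⟩ := h
  have hB : ∀ i, MeasurableSet[ℱ k] {ω | (k : WithTop ℕ) < τ i ω} := fun i =>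
    (hτ.isStoppingTime i).measurableSet_gt k
  have heq : ∀ i j, j ≤ k + 1 → Set.EqOn
      (stoppedProcess (fun n => {ω | ⊥ < τ i ω}.indicator (f n)) (τ i) j) (f j)
      {ω | (k : WithTop ℕ) < τ i ω} := by
    intro i j hj ω hω
    have hω' : (k : WithTop ℕ) < τ i ω := hω
    have h1 : ((k + 1 : ℕ) : WithTop ℕ) ≤ τ i ω := by
      cases hc : τ i ω with
      | top => exact le_top
      | coe n =>
        rw [hc] at hω'
        exact WithTop.coe_le_coe.2 (Nat.succ_le_of_lt (WithTop.coe_lt_coe.1 hω'))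
    rw [stoppedProcess_eq_of_le ((WithTop.coe_le_coe.2 hj).trans h1), Set.indicator_of_mem]
    exact lt_of_le_of_lt bot_le hω'
  refine ⟨fun i => {ω | (k : WithTop ℕ) < τ i ω}, hB, ?_, fun i => ⟨?_, ?_, fun A hA => ?_⟩⟩
  · filter_upwards [hτ.tendsto_top] with ω hω
    exact hω.eventually (lt_mem_nhds (WithTop.coe_lt_top k))
  · exact ((hM i).integrable k).integrableOn.congr_fun (heq i k k.le_succ) (ℱ.le k _ (hB i))
  · exact ((hM i).integrable (k + 1)).integrableOn.congr_fun (heq i (k + 1) le_rfl)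
      (ℱ.le k _ (hB i))
  · have hAB := hA.inter (hB i)
    have h1 := (hM i).setIntegral_eq k.le_succ hAB
    rw [setIntegral_congr_fun (ℱ.le k _ hAB) ((heq i k k.le_succ).mono Set.inter_subset_right),
      setIntegral_congr_fun (ℱ.le k _ hAB)
        ((heq i (k + 1) le_rfl).mono Set.inter_subset_right)] at h1
    exact h1.symm

/-- A local martingale which is integrable at time `k + 1` is integrable at time `k`. -/
theorem IsLocalMartingale.integrable_of_succ [IsFiniteMeasure μ] (h : IsLocalMartingale f ℱ μ)
    {k : ℕ} (hk : Integrable (f (k + 1)) μ) : Integrable (f k) μ := by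
  obtain ⟨B, hB, hev, hBi⟩ := h.exists_localizing_sets k
  refine ⟨((h.1 k).mono (ℱ.le k)).aestronglyMeasurable, ?_⟩
  have hle : ∀ i, ∫⁻ ω, (B i).indicator (fun ω => ‖f k ω‖ₑ) ω ∂μ ≤ ∫⁻ ω, ‖f (k + 1) ω‖ₑ ∂μ := by
    intro i
    have hcond : (B i).indicator (f k) =ᵐ[μ] μ[(B i).indicator (f (k + 1)) | ℱ k] := by
      refine ae_eq_condExp_of_forall_setIntegral_eq (ℱ.le k) (hk.indicator (ℱ.le k _ (hB i)))
        (fun _ _ _ => ((hBi i).1.integrable_indicator (ℱ.le k _ (hB i))).integrableOn)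
        (fun A hA _ => ?_)
        ((h.1 k).indicator (hB i)).aestronglyMeasurable
      rw [setIntegral_indicator (ℱ.le k _ (hB i)), setIntegral_indicator (ℱ.le k _ (hB i)),
        (hBi i).2.2 A hA]
    calc ∫⁻ ω, (B i).indicator (fun ω => ‖f k ω‖ₑ) ω ∂μ
        = eLpNorm ((B i).indicator (f k)) 1 μ := by
          simp only [eLpNorm_one_eq_lintegral_enorm, enorm_indicator_eq_indicator_enorm]
      _ = eLpNorm (μ[(B i).indicator (f (k + 1)) | ℱ k]) 1 μ := eLpNorm_congr_ae hcond
      _ ≤ eLpNorm ((B i).indicator (f (k + 1))) 1 μ := eLpNorm_condExp_le_eLpNorm _ le_rfl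
      _ ≤ eLpNorm (f (k + 1)) 1 μ := eLpNorm_indicator_le _
      _ = ∫⁻ ω, ‖f (k + 1) ω‖ₑ ∂μ := eLpNorm_one_eq_lintegral_enorm
  have hlim : ∀ᵐ ω ∂μ, ‖f k ω‖ₑ =
      liminf (fun i => (B i).indicator (fun ω => ‖f k ω‖ₑ) ω) atTop := by
    filter_upwards [hev] with ω hω
    refine (Tendsto.liminf_eq (tendsto_const_nhds.congr' ?_)).symm
    filter_upwards [hω] with i hi
    rw [Set.indicator_of_mem hi]
  calc ∫⁻ ω, ‖f k ω‖ₑ ∂μ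
      = ∫⁻ ω, liminf (fun i => (B i).indicator (fun ω => ‖f k ω‖ₑ) ω) atTop ∂μ :=
        lintegral_congr_ae hlim
    _ ≤ liminf (fun i => ∫⁻ ω, (B i).indicator (fun ω => ‖f k ω‖ₑ) ω ∂μ) atTop :=
        lintegral_liminf_le fun i =>
          ((h.1 k).mono (ℱ.le k)).enorm.indicator (ℱ.le k _ (hB i))
    _ ≤ ∫⁻ ω, ‖f (k + 1) ω‖ₑ ∂μ := liminf_le_of_frequently_le' (Frequently.of_forall hle)
    _ < ∞ := hk.2

theorem IsLocalMartingale.integrable_of_le [IsFiniteMeasure μ] (h : IsLocalMartingale f ℱ μ)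
    {n : ℕ} (hn : Integrable (f n) μ) {k : ℕ} (hk : k ≤ n) : Integrable (f k) μ :=
  Nat.decreasingInduction (motive := fun k _ => Integrable (f k) μ)
    (fun _ _ => h.integrable_of_succ) hn hk

theorem IsLocalMartingale.setIntegral_succ [IsFiniteMeasure μ] (h : IsLocalMartingale f ℱ μ)
    {k : ℕ} (hk : Integrable (f k) μ) (hk' : Integrable (f (k + 1)) μ) {A : Set Ω}
    (hA : MeasurableSet[ℱ k] A) : ∫ ω in A, f (k + 1) ω - f k ω ∂μ = 0 := by
  obtain ⟨B, hB, hev, hBi⟩ := h.exists_localizing_sets k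
  have hzero : ∀ i, ∫ ω in A, (B i).indicator (fun ω => f (k + 1) ω - f k ω) ω ∂μ = 0 := by
    intro i
    rw [setIntegral_indicator (ℱ.le k _ (hB i)),
      integral_sub hk'.integrableOn hk.integrableOn, (hBi i).2.2 A hA, sub_self]
  have hlim : Tendsto (fun i => ∫ ω in A, (B i).indicator (fun ω => f (k + 1) ω - f k ω) ω ∂μ)
      atTop (𝓝 (∫ ω in A, f (k + 1) ω - f k ω ∂μ)) := by
    refine tendsto_integral_of_dominated_convergence (fun ω => ‖f (k + 1) ω - f k ω‖)
      (fun i => ((hk'.sub hk).aestronglyMeasurable.indicator (ℱ.le k _ (hB i))).restrict)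
      (hk'.sub hk).norm.integrableOn
      (fun i => ae_of_all _ fun ω => norm_indicator_le_norm_self _ _) ?_
    filter_upwards [ae_restrict_of_ae hev] with ω hω
    refine tendsto_const_nhds.congr' ?_
    filter_upwards [hω] with i hi
    rw [Set.indicator_of_mem hi]
  simp only [hzero] at hlim
  exact (tendsto_nhds_unique hlim tendsto_const_nhds)

end LocalMartingale

/-! ### Equivalence with the estimate for local martingales -/

section Equivalence

variable {𝕜 : Type u} [RCLike 𝕜] {X : Type v} [NormedAddCommGroup X] [NormedSpace 𝕜 X]
  [NormedSpace ℝ X] [IsScalarTower ℝ 𝕜 X] [CompleteSpace X] {p β : ℝ}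

/-- If `f n ∉ L^p`, the estimate is trivial. Otherwise the local martingale `f` is integrable up to
time `n`, hence so is `g`, and the differences of `g` are a transform of those of `f`. -/
theorem ZigzagBound.weakSubBound (hp : 1 ≤ p) (hβ : 0 ≤ β) (h : ZigzagBound 𝕜 X p β) :
    WeakSubBound.{u, v, w} 𝕜 X p β := by
  intro Ω m μ _ ℱ f g _ hf hg hsub n _
  have hp0 : 0 < p := by linarith
  by_cases htop : ∫⁻ ω, ‖f n ω‖ₑ ^ p ∂μ = ∞
  · exact h.lintegral_le_of_eq_top hp0 hβ _ htop
  have hfL : MemLp (f n) (ENNReal.ofReal p) μ := by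
    refine ⟨((hf.1 n).mono (ℱ.le n)).aestronglyMeasurable, ?_⟩
    rw [eLpNorm_lt_top_iff_lintegral_rpow_enorm_lt_top (by simpa using hp0) ENNReal.ofReal_ne_top,
      ENNReal.toReal_ofReal hp0.le]
    exact lt_top_iff_ne_top.2 htop
  have hfi : ∀ k ≤ n, Integrable (f k) μ := fun k hk =>
    hf.integrable_of_le (hfL.integrable (by simpa using ENNReal.ofReal_le_ofReal hp)) hk
  obtain ⟨a, -, ha, h0, hs⟩ := (weaklyDiffSubordinate_iff hf.1 hg.1).1 hsub
  have hgi : ∀ k ≤ n, Integrable (g k) μ := by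
    intro k
    induction k with
    | zero =>
      intro hk
      refine (hfi 0 hk).mono ((hg.1 0).mono (ℱ.le 0)).aestronglyMeasurable ?_
      filter_upwards [ha 0, h0] with ω h1 h2
      rw [h2, norm_smul]
      exact mul_le_of_le_one_left (norm_nonneg _) h1
    | succ k ih =>
      intro hk
      have hd : Integrable (fun ω => g (k + 1) ω - g k ω) μ := by
        refine ((hfi (k + 1) hk).sub (hfi k (by omega))).mono
          (((hg.1 (k + 1)).mono (ℱ.le _)).sub ((hg.1 k).mono (ℱ.le _))).aestronglyMeasurable ?_
        filter_upwards [ha (k + 1), hs k] with ω h1 h2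
        rw [h2, norm_smul]
        exact mul_le_of_le_one_left (norm_nonneg _) h1
      exact (hd.add (ih (by omega))).congr (ae_of_all _ fun ω => by simp)
  -- the differences of a process
  let D : (ℕ → Ω → X) → ℕ → Ω → X := fun u k =>
    Nat.casesOn k (u 0) fun j ω => u (j + 1) ω - u j ω
  have hDm : ∀ u : ℕ → Ω → X, StronglyAdapted ℱ u → ∀ k, StronglyMeasurable[ℱ k] (D u k) := by
    intro u hu k
    cases k with
    | zero => exact hu 0
    | succ k => exact (hu (k + 1)).sub ((hu k).mono (ℱ.mono k.le_succ))
  have hDsum : ∀ (u : ℕ → Ω → X) ω, ∑ k ∈ Finset.range (n + 1), D u k ω = u n ω := by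
    intro u ω
    rw [Finset.sum_range_succ']
    exact (congrArg (· + u 0 ω) (Finset.sum_range_sub (fun j => u j ω) n)).trans
      (sub_add_cancel _ _)
  have hT : IsTransformUpTo 𝕜 (D g) (D f) ℱ μ (n + 1) :=
    { adapted := fun k _ => hDm f hf.1 k
      adapted' := fun k _ => hDm g hg.1 k
      setIntegral_succ := fun k hk _ hA =>
        hf.setIntegral_succ (hfi k (by omega)) (hfi (k + 1) (by omega)) hA
      setIntegral_succ' := fun k hk _ hA =>
        hg.setIntegral_succ (hgi k (by omega)) (hgi (k + 1) (by omega)) hA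
      exists_smul := fun k _ => by
        cases k with
        | zero => filter_upwards [ha 0, h0] with ω h1 h2 using ⟨_, h1, h2⟩
        | succ k => filter_upwards [ha (k + 1), hs k] with ω h1 h2 using ⟨_, h1, h2⟩ }
  have key := hT.lintegral_le_of_integrable hp hβ h fun k hk => by
    cases k with
    | zero => exact hfi 0 n.zero_le
    | succ k => exact (hfi (k + 1) (by omega)).sub (hfi k (by omega))
  simpa only [hDsum] using key

/-- The filtration `ℱ` with its initial σ-algebra replaced by the trivial one. -/
def MeasureTheory.Filtration.trivialZero {Ω : Type*} {m : MeasurableSpace Ω} (ℱ : Filtration ℕ m) :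
    Filtration ℕ m where
  seq k := if k = 0 then ⊥ else ℱ k
  mono' i j hij := by
    dsimp only
    split_ifs
    · exact le_rfl
    · exact bot_le
    · omega
    · exact ℱ.mono hij
  le' i := by
    split_ifs
    · exact bot_le
    · exact ℱ.le i

omit [NormedSpace 𝕜 X] [IsScalarTower ℝ 𝕜 X] in
/-- The sums `d 1 + ⋯ + d n` are a martingale even when the initial σ-algebra is made trivial. -/
theorem IsMartingaleDiff.martingale_trivialZero {Ω : Type*} {m : MeasurableSpace Ω} {μ : Measure Ω}
    [IsProbabilityMeasure μ] {ℱ : Filtration ℕ m} {d : ℕ → Ω → X} (hd : IsMartingaleDiff d ℱ μ) :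
    Martingale (fun n ω => ∑ j ∈ Finset.range n, d (j + 1) ω) ℱ.trivialZero μ := by
  have hle : ∀ k, ℱ.trivialZero k ≤ ℱ k := fun k => by
    change (if k = 0 then ⊥ else (ℱ k : MeasurableSpace Ω)) ≤ _
    split_ifs
    · exact bot_le
    · exact le_rfl
  have hge : ∀ k, ℱ (k + 1) ≤ ℱ.trivialZero (k + 1) := fun k => le_rfl
  refine martingale_of_setIntegral_eq_succ (fun n => ?_) (fun n => ?_) fun n A hA => ?_
  · cases n with
    | zero => simpa using stronglyMeasurable_const
    | succ n =>
      exact Finset.stronglyMeasurable_fun_sum _ fun j hj => (hd.adapted (j + 1)).mono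
        ((ℱ.mono (by rw [Finset.mem_range] at hj; omega)).trans (hge n))
  · exact integrable_finsetSum _ fun j _ => hd.integrable _
  · simp only [Finset.sum_range_succ _ n]
    rw [integral_add (integrable_finsetSum _ fun j _ => (hd.integrable _).integrableOn)
      (hd.integrable _).integrableOn,
      setIntegral_eq_zero_of_condExp (ℱ.le n) (hd.integrable _) (hd.condExp_succ n) (hle n _ hA),
      add_zero]

/-- Apply the estimate to the partial sums from `d 1` on. -/
theorem WeakSubBound.umdBound (hp : 0 < p) (h : WeakSubBound.{u, v, w} 𝕜 X p β) :
    UMDBound.{u, v, w} 𝕜 X p β := by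
  intro Ω m μ _ ℱ d hd _ ε hε n hn
  rw [eLpNorm_le_ofReal_mul_iff hp]
  have key := h Ω m μ inferInstance ℱ.trivialZero (fun n ω => ∑ j ∈ Finset.range n, d (j + 1) ω)
    (fun n ω => ∑ j ∈ Finset.range n, ε (j + 1) • d (j + 1) ω) rfl
    ⟨hd.martingale_trivialZero.1, Locally.of_prop hd.martingale_trivialZero⟩
    ⟨(hd.smul ε).martingale_trivialZero.1, Locally.of_prop (hd.smul ε).martingale_trivialZero⟩
    ⟨fun φ => by simp, fun n φ => ae_of_all _ fun ω => by
      simp [Finset.sum_range_succ _ n, hε]⟩ n hn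
  simpa only [sum_Icc_one_eq_sum_range] using key

theorem weakSubBound_iff_umdBound (hp : 1 ≤ p) (hβ : 0 ≤ β) :
    WeakSubBound.{u, v, w} 𝕜 X p β ↔ UMDBound.{u, v, w} 𝕜 X p β :=
  ⟨fun h => h.umdBound (by linarith), fun h =>
    ((umdBound_iff_zigzagBound hp hβ).1 h).weakSubBound hp hβ⟩

end Equivalence

theorem theorem3p3 {𝕜 : Type u} [RCLike 𝕜] {X : Type v} [NormedAddCommGroup X]
    [NormedSpace 𝕜 X] [NormedSpace ℝ X] [IsScalarTower ℝ 𝕜 X] [CompleteSpace X] :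
    -- UMD is equivalent to the estimate for some `p`, and to the estimate for all `p`
    (IsUMD.{u, v, w} 𝕜 X ↔
      ∃ p : ℝ, 1 < p ∧ ∃ β : ℝ, 0 < β ∧ WeakSubBound.{u, v, w} 𝕜 X p β) ∧
    (IsUMD.{u, v, w} 𝕜 X ↔
      ∀ p : ℝ, 1 < p → ∃ β : ℝ, 0 < β ∧ WeakSubBound.{u, v, w} 𝕜 X p β) ∧
    -- the best constant in the estimate is the UMD constant
    (IsUMD.{u, v, w} 𝕜 X → ∀ p : ℝ, 1 < p →
      IsLeast {β : ℝ | 0 ≤ β ∧ UMDBound.{u, v, w} 𝕜 X p β} (umdConst.{u, v, w} 𝕜 X p) ∧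
      IsLeast {β : ℝ | 0 ≤ β ∧ WeakSubBound.{u, v, w} 𝕜 X p β} (umdConst.{u, v, w} 𝕜 X p)) ∧
    -- weak differential subordination amounts to `dg = a df` with `a` adapted and `|a| ≤ 1`
    (∀ (Ω : Type w) (m : MeasurableSpace Ω) (μ : Measure Ω) (_ : IsProbabilityMeasure μ)
      (ℱ : Filtration ℕ m) (f g : ℕ → Ω → X),
      IsLocalMartingale f ℱ μ → IsLocalMartingale g ℱ μ →
      (WeaklyDiffSubordinate 𝕜 g f μ ↔
        ∃ a : ℕ → Ω → 𝕜, StronglyAdapted ℱ a ∧ (∀ n, ∀ᵐ ω ∂μ, ‖a n ω‖ ≤ 1) ∧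
          (∀ᵐ ω ∂μ, g 0 ω = a 0 ω • f 0 ω) ∧
          ∀ n, ∀ᵐ ω ∂μ, g (n + 1) ω - g n ω = a (n + 1) ω • (f (n + 1) ω - f n ω))) ∧
    -- the estimate for transforms of martingale difference sequences: for the partial sums, and
    -- for the full sums when `∑ d n` converges in `L^p`
    (IsUMD.{u, v, w} 𝕜 X → ∀ (Ω : Type w) (m : MeasurableSpace Ω) (μ : Measure Ω)
      (_ : IsProbabilityMeasure μ) (ℱ : Filtration ℕ m) (d e : ℕ → Ω → X) (a : ℕ → Ω → 𝕜),
      IsMartingaleDiff d ℱ μ → IsMartingaleDiff e ℱ μ → StronglyAdapted ℱ a →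
      (∀ n, ∀ᵐ ω ∂μ, ‖a n ω‖ ≤ 1) → (∀ n, ∀ᵐ ω ∂μ, e n ω = a n ω • d n ω) →
      ∀ p : ℝ, 1 < p →
        (∀ n : ℕ, ∫⁻ ω, ‖∑ k ∈ Finset.range n, e k ω‖ₑ ^ p ∂μ ≤
          ENNReal.ofReal (umdConst.{u, v, w} 𝕜 X p) ^ p *
            ∫⁻ ω, ‖∑ k ∈ Finset.range n, d k ω‖ₑ ^ p ∂μ) ∧
        ∀ D : Ω → X, MemLp D (ENNReal.ofReal p) μ →
          Tendsto (fun n => eLpNorm (fun ω => (∑ k ∈ Finset.range n, d k ω) - D ω)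
            (ENNReal.ofReal p) μ) atTop (𝓝 0) →
          ∃ S : Ω → X, MemLp S (ENNReal.ofReal p) μ ∧
            Tendsto (fun n => eLpNorm (fun ω => (∑ k ∈ Finset.range n, e k ω) - S ω)
              (ENNReal.ofReal p) μ) atTop (𝓝 0) ∧
            ∫⁻ ω, ‖S ω‖ₑ ^ p ∂μ ≤ ENNReal.ofReal (umdConst.{u, v, w} 𝕜 X p) ^ p *
              ∫⁻ ω, ‖D ω‖ₑ ^ p ∂μ) := by
  refine ⟨⟨fun h => ?_, fun ⟨p, hp, β, hβ, h⟩ => ⟨p, hp, β, hβ, h.umdBound (by linarith)⟩⟩,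
    ⟨fun h p hp => ?_, fun h => ?_⟩, fun h p hp => ?_, ?_, ?_⟩
  · obtain ⟨p, hp, β, hβ, hb⟩ := h
    exact ⟨p, hp, β, hβ, (weakSubBound_iff_umdBound hp.le hβ.le).2 hb⟩
  · obtain ⟨β, hβ, hb⟩ := h.exists_zigzagBound hp
    exact ⟨β, hβ, hb.weakSubBound hp.le hβ.le⟩
  · obtain ⟨β, hβ, hb⟩ := h 2 one_lt_two
    exact ⟨2, one_lt_two, β, hβ, hb.umdBound two_pos⟩
  · have hset : {β : ℝ | 0 ≤ β ∧ WeakSubBound.{u, v, w} 𝕜 X p β} =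
        {β : ℝ | 0 ≤ β ∧ UMDBound.{u, v, w} 𝕜 X p β} := by
      ext β
      exact and_congr_right fun hβ => weakSubBound_iff_umdBound hp.le hβ
    obtain ⟨h0, hz⟩ := h.umdConst_mem hp
    rw [hset, and_self]
    exact ⟨⟨h0, hz.umdBound hp.le h0⟩, fun β hβ => csInf_le ⟨0, fun _ h => h.1⟩ hβ⟩
  · intro Ω m μ _ ℱ f g hf hg
    exact weaklyDiffSubordinate_iff hf.1 hg.1
  · intro h Ω m μ _ ℱ d e a hd he _ ha hea p hp
    obtain ⟨h0, hz⟩ := h.umdConst_mem hp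
    have hde : ∀ k, ∀ᵐ ω ∂μ, ∃ a : 𝕜, ‖a‖ ≤ 1 ∧ e k ω = a • d k ω := fun k => by
      filter_upwards [ha k, hea k] with ω h1 h2 using ⟨_, h1, h2⟩
    exact ⟨fun n => (hd.isTransformUpTo he hde n).lintegral_le_of_integrable hp.le h0 hz
      fun k _ => hd.integrable k, fun D hD hlim => hz.exists_limit hp.le h0 hd he hde hD hlim⟩
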